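/- Let $d\in\{2,3\}$ and let $\Omega\subset\mathbb R^d$ be a polygonal (polyhedral) domain, i.e. a nonempty connected open set with $\operatorname{int}\overline\Omega=\Omega$ whose closure is a finite union of closed nondegenerate simplices. Let $(\cdot,\cdot)_1$ and $\|\cdot\|_1$ denote the standard scalar product and norm of $H^1(\Omega)$ and of $\mathbf H^1(\Omega)=H^1(\Omega)^d$. Let $k\ge 1$ and let $\hat{\mathbf z}\in H^{k+1,\infty}(\Omega)^d$ satisfy $\|\hat{\mathbf z}\|=1$ a.e. on $\Omega$. Put $$a(\mathbf v,\mathbf w)=\int_\Omega \mathbf E(\mathbf v):\mathbf E(\mathbf w)\,dx,\quad \mathbf E(\mathbf v)=\nabla\mathbf v+\nabla\mathbf v^T,\qquad b(\mu,\mathbf v)=(\mu,\mathbf v\cdot\hat{\mathbf z})_1,$$ $$K=\{\mathbf v\in\mathbf H^1(\Omega): a(\mathbf v,\mathbf v)=0\},\qquad \ker(b)=\{\mathbf v\in\mathbf H^1(\Omega): b(\mu,\mathbf v)=0\ \ \forall \mu\in H^1(\Omega)\},\qquad \mathcal K_{\hat{\mathbf z}}=\ker(b)\cap K.$$ Let $\{\mathcal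 T_h\}$ be a shape regular (not necessarily quasi-uniform) family of conforming simplicial triangulations of $\Omega$, where $h=\max_{T\in\mathcal T_h}\operatorname{diam}T$. Let $V_h$ be the space of continuous functions on $\Omega$ that are polynomials of degree at most $k$ on each $T\in\mathcal T_h$, and put $\mathbf V_h=V_h^d$, $$\ker_h(b)=\{\mathbf v_h\in\mathbf V_h: b(\mu_h,\mathbf v_h)=0\ \ \forall \mu_h\in V_h\},\qquad \mathcal K_{\hat{\mathbf z},h}=\ker_h(b)\cap K,$$ $$\operatorname{dist}(\mathcal K_{\hat{\mathbf z},h},\mathcal K_{\hat{\mathbf z}})=\sup_{\mathbf w\in\mathcal K_{\hat{\mathbf z},h},\ \|\mathbf w\|_1=1}\ \inf_{\mathbf v\in\mathcal K_{\hat{\mathbf z}}}\|\mathbf w-\mathbf v\|_1$$ (with value $0$ if $\mathcal K_{\hat{\mathbf z},h}=\{0\}$). Then there is a constant $c$ independent of $h$ such that $$\operatorname{dist}(\mathcal K_{\hat{\mathbf z},h},\mathcal K_{\hat{\mathbf z}})\le c\,h^k$$ for all members of the family. Moreover, there is $h_0>0$ such that $\mathcal K_{\hat{\mathbf z}}=\mathcal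 K_{\hat{\mathbf z},h}$ for all members with $h<h_0$. -/

import Mathlib

open MeasureTheory
open scoped ContDiff ENNReal

noncomputable section

namespace StrainEnergy

/-- `ℝ^d` with the Euclidean norm. -/
abbrev Pt (d : ℕ) : Type := EuclideanSpace ℝ (Fin d)

/-- The `i`-th standard basis vector of `ℝ^d`. -/
abbrev basisVec {d : ℕ} (i : Fin d) : Pt d := EuclideanSpace.single i (1 : ℝ)

/-! ### Sobolev spaces -/

/-- Test functions on `Ω`: smooth, with compact support contained in `Ω`. -/
structure IsTestFun {d : ℕ} (Ω : Set (Pt d)) (φ : Pt d → ℝ) : Prop where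
  smooth : ContDiff ℝ ∞ φ
  compact : HasCompactSupport φ
  support : tsupport φ ⊆ Ω

/-- `g` is a weak partial derivative `∂_i f` on `Ω`. -/
structure HasWeakPartial {d : ℕ} (Ω : Set (Pt d)) (i : Fin d) (f g : Pt d → ℝ) : Prop where
  locInt : LocallyIntegrableOn f Ω
  locInt_partial : LocallyIntegrableOn g Ω
  integral_eq : ∀ φ : Pt d → ℝ, IsTestFun Ω φ →
    ∫ x in Ω, f x * fderiv ℝ φ x (basisVec i) = -∫ x in Ω, g x * φ x

/-- `f` belongs to the Sobolev space `H^{m,∞}(Ω) = W^{m,∞}(Ω)`: `f` and all its weak partial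
derivatives up to order `m` exist and are essentially bounded on `Ω`. -/
def MemSobolevInf {d : ℕ} (Ω : Set (Pt d)) : ℕ → (Pt d → ℝ) → Prop
  | 0, f => MemLp f ∞ (volume.restrict Ω)
  | m + 1, f => MemLp f ∞ (volume.restrict Ω) ∧
      ∀ i : Fin d, ∃ g : Pt d → ℝ, HasWeakPartial Ω i f g ∧ MemSobolevInf Ω m g

/-- `L²(Ω)`. -/
abbrev L2 {d : ℕ} (Ω : Set (Pt d)) : Type := Lp ℝ 2 (volume.restrict Ω)

theorem integrable_mul_of_test {d : ℕ} {Ω : Set (Pt d)} (f : L2 Ω) {ψ : Pt d → ℝ}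
    (hc : Continuous ψ) (hs : HasCompactSupport ψ) :
    Integrable (fun x => f x * ψ x) (volume.restrict Ω) :=
  (Lp.memLp f).integrable_mul (q := 2) (hc.memLp_of_hasCompactSupport hs)

theorem L2.locallyIntegrableOn {d : ℕ} {Ω : Set (Pt d)} (f : L2 Ω) :
    LocallyIntegrableOn f Ω :=
  locallyIntegrableOn_of_locallyIntegrable_restrict
    ((Lp.memLp f).locallyIntegrable (by norm_num))

theorem IsTestFun.continuous_partial {d : ℕ} {Ω : Set (Pt d)} {φ : Pt d → ℝ}
    (hφ : IsTestFun Ω φ) (i : Fin d) : Continuous fun x => fderiv ℝ φ x (basisVec i) :=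
  (hφ.smooth.continuous_fderiv (by simp)).clm_apply continuous_const

theorem IsTestFun.compact_partial {d : ℕ} {Ω : Set (Pt d)} {φ : Pt d → ℝ}
    (hφ : IsTestFun Ω φ) (i : Fin d) :
    HasCompactSupport fun x => fderiv ℝ φ x (basisVec i) :=
  hφ.compact.fderiv_apply ℝ (basisVec i)

/-- The Sobolev space `H¹(Ω)`. An element is a function `u ∈ L²(Ω)` together with its weak gradient
`(∂_1 u, …, ∂_d u) ∈ L²(Ω)^d` (which is determined by `u`); the inner product inherited from the
ambient Hilbert sum is `(u, v)_1 = ∫_Ω u v + ∇u · ∇v`. -/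
def H1 {d : ℕ} (Ω : Set (Pt d)) :
    Submodule ℝ (WithLp 2 (L2 Ω × PiLp 2 fun _ : Fin d => L2 Ω)) where
  carrier := {p | ∀ i, HasWeakPartial Ω i p.fst (p.snd i)}
  zero_mem' := by
    intro i
    refine ⟨L2.locallyIntegrableOn _, L2.locallyIntegrableOn _, fun φ hφ => ?_⟩
    have h : ((0 : L2 Ω) : Pt d → ℝ) =ᵐ[volume.restrict Ω] 0 := Lp.coeFn_zero _ _ _
    have key : ∀ ψ : Pt d → ℝ, ∫ x in Ω, (0 : L2 Ω) x * ψ x = 0 := by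
      intro ψ
      apply integral_eq_zero_of_ae
      filter_upwards [h] with x hx
      rw [hx]
      exact zero_mul _
    change ∫ x in Ω, (0 : L2 Ω) x * _ = -∫ x in Ω, (0 : L2 Ω) x * φ x
    rw [key, key, neg_zero]
  add_mem' := by
    intro p q hp hq i
    refine ⟨L2.locallyIntegrableOn _, L2.locallyIntegrableOn _, fun φ hφ => ?_⟩
    have key : ∀ (f g : L2 Ω) (ψ : Pt d → ℝ), Continuous ψ → HasCompactSupport ψ →
        ∫ x in Ω, (f + g : L2 Ω) x * ψ x = (∫ x in Ω, f x * ψ x) + ∫ x in Ω, g x * ψ x := by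
      intro f g ψ hc hs
      rw [← integral_add (integrable_mul_of_test f hc hs) (integrable_mul_of_test g hc hs)]
      apply integral_congr_ae
      filter_upwards [Lp.coeFn_add f g] with x hx
      rw [hx]
      exact add_mul _ _ _
    have e1 := (hp i).integral_eq φ hφ
    have e2 := (hq i).integral_eq φ hφ
    have k1 := key p.fst q.fst _ (hφ.continuous_partial i) (hφ.compact_partial i)
    have k2 := key (p.snd i) (q.snd i) φ hφ.smooth.continuous hφ.compact
    change ∫ x in Ω, (p.fst + q.fst : L2 Ω) x * _ = -∫ x in Ω, (p.snd i + q.snd i : L2 Ω) x * φ x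
    rw [k1, k2, e1, e2]
    ring
  smul_mem' := by
    intro c p hp i
    refine ⟨L2.locallyIntegrableOn _, L2.locallyIntegrableOn _, fun φ hφ => ?_⟩
    have key : ∀ (f : L2 Ω) (ψ : Pt d → ℝ),
        ∫ x in Ω, (c • f : L2 Ω) x * ψ x = c * ∫ x in Ω, f x * ψ x := by
      intro f ψ
      rw [← integral_const_mul]
      apply integral_congr_ae
      filter_upwards [Lp.coeFn_smul c f] with x hx
      rw [hx]
      exact mul_assoc _ _ _
    change ∫ x in Ω, (c • p.fst : L2 Ω) x * _ = -∫ x in Ω, (c • p.snd i : L2 Ω) x * φ x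
    rw [key, key, (hp i).integral_eq φ hφ]
    ring

/-- The underlying function of an element of `H¹(Ω)`. -/
def val {d : ℕ} {Ω : Set (Pt d)} (u : H1 Ω) : L2 Ω := u.1.fst

/-- The weak partial derivative `∂_i u` of an element of `H¹(Ω)`. -/
def weakGrad {d : ℕ} {Ω : Set (Pt d)} (u : H1 Ω) (i : Fin d) : L2 Ω := u.1.snd i

/-- The space `H¹(Ω)^d` of vector fields, with inner product `(v, w)_1 = ∑_i (v_i, w_i)_1`. -/
abbrev H1Vec {d : ℕ} (Ω : Set (Pt d)) : Type := PiLp 2 fun _ : Fin d => H1 Ω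

open Classical in
/-- The element of `H¹(Ω)` represented by a function `f : ℝ^d → ℝ` whose restriction to `Ω` belongs
to `H¹(Ω)` (and `0` for other functions). -/
def ofFun {d : ℕ} (Ω : Set (Pt d)) (f : Pt d → ℝ) : H1 Ω :=
  if h : ∃ u : H1 Ω, val u =ᵐ[volume.restrict Ω] f then h.choose else 0

/-! ### Strain energy, rigid motions and the constraint -/

/-- The entry `(i, j)` of the tensor `E(v) = ∇v + ∇vᵀ`. -/
def strain {d : ℕ} {Ω : Set (Pt d)} (v : H1Vec Ω) (i j : Fin d) : L2 Ω :=
  weakGrad (v i) j + weakGrad (v j) i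

/-- `a(v, w) = ∫_Ω E(v) : E(w)`. -/
def aForm {d : ℕ} {Ω : Set (Pt d)} (v w : H1Vec Ω) : ℝ :=
  ∫ x in Ω, ∑ i, ∑ j, strain v i j x * strain w i j x

/-- The space `K = {v ∈ H¹(Ω)^d | a(v, v) = 0}` of rigid motions. -/
def rigidMotions {d : ℕ} (Ω : Set (Pt d)) : Set (H1Vec Ω) := {v | aForm v v = 0}

/-- The scalar function `v · ẑ`, as an element of `H¹(Ω)`. For `ẑ ∈ H^{1,∞}(Ω)^d` and
`v ∈ H¹(Ω)^d` this function does belong to `H¹(Ω)`. -/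
def dotField {d : ℕ} {Ω : Set (Pt d)} (z : Pt d → Pt d) (v : H1Vec Ω) : H1 Ω :=
  ofFun Ω fun x => ∑ i, val (v i) x * z x i

/-- `b(μ, v) = (μ, v · ẑ)_1`. -/
def bForm {d : ℕ} {Ω : Set (Pt d)} (z : Pt d → Pt d) (μ : H1 Ω) (v : H1Vec Ω) : ℝ :=
  inner ℝ μ (dotField z v)

/-- `ker b = {v ∈ H¹(Ω)^d | b(μ, v) = 0 for all μ ∈ H¹(Ω)}`. -/
def kerB {d : ℕ} (Ω : Set (Pt d)) (z : Pt d → Pt d) : Set (H1Vec Ω) :=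
  {v | ∀ μ : H1 Ω, bForm z μ v = 0}

/-- The kernel `K_ẑ = ker b ∩ K`. -/
def kernelSpace {d : ℕ} (Ω : Set (Pt d)) (z : Pt d → Pt d) : Set (H1Vec Ω) :=
  kerB Ω z ∩ rigidMotions Ω

/-! ### Triangulations and finite element spaces -/

/-- A (conforming, finite) simplicial triangulation of `Ω`: a finite geometric simplicial complex
with underlying space the closure of `Ω`. -/
structure Triangulation {d : ℕ} (Ω : Set (Pt d)) where
  complex : Geometry.SimplicialComplex ℝ (Pt d)
  finite : complex.faces.Finite
  space_eq : complex.space = closure Ω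

/-- The (closed, nondegenerate) `d`-simplices `T ∈ 𝒯`. -/
def Triangulation.cells {d : ℕ} {Ω : Set (Pt d)} (𝒯 : Triangulation Ω) : Set (Set (Pt d)) :=
  {T | ∃ s ∈ 𝒯.complex.faces, s.card = d + 1 ∧ T = convexHull ℝ (s : Set (Pt d))}

/-- The mesh size `h = max {diam T | T ∈ 𝒯}`. -/
def Triangulation.meshSize {d : ℕ} {Ω : Set (Pt d)} (𝒯 : Triangulation Ω) : ℝ :=
  sSup (Metric.diam '' 𝒯.cells)

/-- A family of triangulations is shape regular if the ratio of the diameter of a cell to the radius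
of a ball contained in the cell is bounded uniformly over all cells of all members. -/
def ShapeRegular {d : ℕ} {Ω : Set (Pt d)} {ι : Type*} (𝒯 : ι → Triangulation Ω) : Prop :=
  ∃ σ : ℝ, ∀ i, ∀ T ∈ (𝒯 i).cells,
    ∃ (x : Pt d) (r : ℝ), 0 < r ∧ Metric.closedBall x r ⊆ T ∧ Metric.diam T ≤ σ * r

/-- `Ω` is a polygonal (polyhedral) domain: a nonempty connected open set that lies on one side of
its boundary (no slits) and whose closure is a finite union of closed nondegenerate simplices. -/
structure IsPolygonalDomain {d : ℕ} (Ω : Set (Pt d)) : Prop where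
  isOpen : IsOpen Ω
  isConnected : IsConnected Ω
  interior_closure : interior (closure Ω) = Ω
  polygonal : ∃ S : Finset (Affine.Simplex ℝ (Pt d) d),
    closure Ω = ⋃ T ∈ S, T.closedInterior

/-- The scalar finite element space `V_h` of continuous functions on `Ω` that are polynomials of
degree at most `k` on every cell. -/
def feSpace {d : ℕ} {Ω : Set (Pt d)} (k : ℕ) (𝒯 : Triangulation Ω) : Set (H1 Ω) :=
  {u | ∃ f : Pt d → ℝ, val u =ᵐ[volume.restrict Ω] f ∧ ContinuousOn f Ω ∧
    ∀ T ∈ 𝒯.cells, ∃ p : MvPolynomial (Fin d) ℝ, p.totalDegree ≤ k ∧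
      ∀ x ∈ T ∩ Ω, f x = MvPolynomial.eval (fun i => x i) p}

/-- The vector-valued finite element space `V_h^d`. -/
def feSpaceVec {d : ℕ} {Ω : Set (Pt d)} (k : ℕ) (𝒯 : Triangulation Ω) : Set (H1Vec Ω) :=
  {v | ∀ i, v i ∈ feSpace k 𝒯}

/-- `ker_h b = {v_h ∈ V_h^d | b(μ_h, v_h) = 0 for all μ_h ∈ V_h}`. -/
def kerBh {d : ℕ} {Ω : Set (Pt d)} (k : ℕ) (𝒯 : Triangulation Ω) (z : Pt d → Pt d) :
    Set (H1Vec Ω) :=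
  {v | v ∈ feSpaceVec k 𝒯 ∧ ∀ μ ∈ feSpace k 𝒯, bForm z μ v = 0}

/-- The discrete kernel `K_{ẑ,h} = ker_h b ∩ K`. -/
def discreteKernel {d : ℕ} {Ω : Set (Pt d)} (k : ℕ) (𝒯 : Triangulation Ω) (z : Pt d → Pt d) :
    Set (H1Vec Ω) :=
  kerBh k 𝒯 z ∩ rigidMotions Ω

/-- The angle distance `dist(A, B) = sup_{w ∈ A, ‖w‖ = 1} inf_{v ∈ B} ‖w - v‖`. For linear subspaces
`A`, `B` it is a supremum of numbers in `[0, 1]`, and it is `0` if `A = {0}`. -/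
def angleDist {X : Type*} [SeminormedAddCommGroup X] (A B : Set X) : ℝ :=
  ⨆ w : {w : X // w ∈ A ∧ ‖w‖ = 1}, ⨅ v : B, ‖(w : X) - v‖

end StrainEnergy

end

noncomputable section

namespace StrainEnergy

variable {d : ℕ} {Ω U : Set (Pt d)} {i : Fin d} {f g f' g' φ ψ : Pt d → ℝ}

/-! ### Calculus of weak partial derivatives -/

/-! The stronger second assertion carries the first. A field with zero strain is affine, so every
rigid motion lies in `V_h^d` (as `k ≥ 1`) and the exact kernel is contained in each discrete one.
For the converse, the products `v · ẑ` with `v` affine form a finite-dimensional space `W ⊆ H¹(Ω)`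
of `H^{2,∞}` functions. Each of them is an `H¹` limit of continuous piecewise affine functions as `h
→ 0`, and compactness of the unit sphere of `W` makes this uniform: below some `h₀`, every unit
vector of `W` is within distance less than `1` of `V_h`, so no nonzero element of `W` is orthogonal
to `V_h`. If `v` lies in the discrete kernel, then `v · ẑ ∈ W` is orthogonal to `V_h`, hence zero,
and `v ∈ ker b`. Thus the distance vanishes for `h < h₀`; for `h ≥ h₀` it is at most `1 ≤ (h /
h₀)^k`.

The load-bearing lemmas are `exists_lipschitz_representative` (a bounded weak gradient gives
Lipschitz bounds on convex subsets), `exists_affine_of_mem_rigidMotions`,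
`exists_feSpace_norm_sub_lt` and `exists_forall_orthogonal_eq_zero`. The delicate point is
interpolation: `Ω` need not be a Lipschitz domain, so an `H^{2,∞}` function may have no continuous
extension to `closure Ω`. Vertex values are therefore taken cell by cell, and
`Triangulation.lineMap_mem` shows that they agree wherever continuity in `Ω` requires it. -/

theorem integrableOn_mul_of_tsupport_subset (hf : LocallyIntegrableOn f Ω) (hΩ : IsOpen Ω)
    (hc : Continuous ψ) (hs : HasCompactSupport ψ) (hsub : tsupport ψ ⊆ Ω) :
    IntegrableOn (fun x => f x * ψ x) Ω := by
  have h1 : IntegrableOn (fun x => f x * ψ x) (tsupport ψ) :=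
    (hf.integrableOn_compact_subset hsub hs).mul_continuousOn hc.continuousOn hs
  refine h1.of_forall_sdiff_eq_zero hΩ.measurableSet fun x hx => ?_
  rw [image_eq_zero_of_notMem_tsupport hx.2, mul_zero]

theorem setIntegral_mul_of_tsupport_subset (hU : MeasurableSet Ω) (h : U ⊆ Ω)
    (hsub : tsupport ψ ⊆ U) : ∫ x in U, f x * ψ x = ∫ x in Ω, f x * ψ x := by
  refine (setIntegral_eq_of_subset_of_forall_sdiff_eq_zero hU h fun x hx => ?_).symm
  rw [image_eq_zero_of_notMem_tsupport fun hx' => hx.2 (hsub hx'), mul_zero]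

namespace IsTestFun

theorem tsupport_partial (hφ : IsTestFun Ω φ) (i : Fin d) :
    tsupport (fun x => fderiv ℝ φ x (basisVec i)) ⊆ Ω :=
  (tsupport_fderiv_apply_subset ℝ _).trans hφ.support

theorem partialDeriv (hφ : IsTestFun Ω φ) (i : Fin d) :
    IsTestFun Ω fun x => fderiv ℝ φ x (basisVec i) :=
  ⟨(hφ.smooth.fderiv_right (m := ∞) (by simp)).clm_apply contDiff_const, hφ.compact_partial i,
    hφ.tsupport_partial i⟩

theorem mono (hφ : IsTestFun U φ) (h : U ⊆ Ω) : IsTestFun Ω φ :=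
  ⟨hφ.smooth, hφ.compact, hφ.support.trans h⟩

theorem smooth_mul {a : Pt d → ℝ} (ha : ContDiff ℝ ∞ a) (hφ : IsTestFun Ω φ) :
    IsTestFun Ω fun x => a x * φ x :=
  ⟨ha.mul hφ.smooth, hφ.compact.mul_left, (closure_mono (Function.support_mul_subset_right a φ)).trans
    hφ.support⟩

theorem integrableOn_mul (hφ : IsTestFun Ω φ) (hΩ : IsOpen Ω) (hf : LocallyIntegrableOn f Ω) :
    IntegrableOn (fun x => f x * φ x) Ω :=
  integrableOn_mul_of_tsupport_subset hf hΩ hφ.smooth.continuous hφ.compact hφ.support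

theorem fderiv_mul_left {a : Pt d → ℝ} (ha : ContDiff ℝ ∞ a) (hφ : IsTestFun Ω φ) (x v : Pt d) :
    fderiv ℝ (fun x => a x * φ x) x v = a x * fderiv ℝ φ x v + φ x * fderiv ℝ a x v := by
  have h1 := (ha.differentiable (by simp) x)
  have h2 := (hφ.smooth.differentiable (by simp) x)
  rw [fderiv_fun_mul h1 h2]
  simp

end IsTestFun

theorem locallyIntegrableOn_mul_smooth {a : Pt d → ℝ} (ha : ContDiff ℝ ∞ a) (hΩ : IsOpen Ω)
    (hf : LocallyIntegrableOn f Ω) : LocallyIntegrableOn (fun x => a x * f x) Ω := by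
  rw [locallyIntegrableOn_iff hΩ.isLocallyClosed] at hf ⊢
  exact fun k hk hc => (hf k hk hc).continuousOn_mul ha.continuous.continuousOn hc

namespace HasWeakPartial

theorem congr (h : HasWeakPartial Ω i f g) (hf : f =ᵐ[volume.restrict Ω] f')
    (hg : g =ᵐ[volume.restrict Ω] g') : HasWeakPartial Ω i f' g' := by
  refine ⟨h.locInt.congr hf, h.locInt_partial.congr hg, fun φ hφ => ?_⟩
  have e1 : ∫ x in Ω, f x * fderiv ℝ φ x (basisVec i) = ∫ x in Ω, f' x * fderiv ℝ φ x (basisVec i) :=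
    integral_congr_ae (hf.mono fun x hx => by simp only [hx])
  have e2 : ∫ x in Ω, g x * φ x = ∫ x in Ω, g' x * φ x :=
    integral_congr_ae (hg.mono fun x hx => by simp only [hx])
  rw [← e1, ← e2, h.integral_eq φ hφ]

theorem mono (h : HasWeakPartial Ω i f g) (hΩ : IsOpen Ω) (hU : U ⊆ Ω) :
    HasWeakPartial U i f g := by
  refine ⟨h.locInt.mono_set hU, h.locInt_partial.mono_set hU, fun φ hφ => ?_⟩
  rw [setIntegral_mul_of_tsupport_subset hΩ.measurableSet hU (hφ.tsupport_partial i),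
    setIntegral_mul_of_tsupport_subset hΩ.measurableSet hU hφ.support,
    h.integral_eq φ (hφ.mono hU)]

theorem add (hΩ : IsOpen Ω) (h : HasWeakPartial Ω i f g) (h' : HasWeakPartial Ω i f' g') :
    HasWeakPartial Ω i (fun x => f x + f' x) fun x => g x + g' x := by
  refine ⟨h.locInt.add h'.locInt, h.locInt_partial.add h'.locInt_partial, fun φ hφ => ?_⟩
  simp only [add_mul]
  rw [integral_add ((hφ.partialDeriv i).integrableOn_mul hΩ h.locInt)
      ((hφ.partialDeriv i).integrableOn_mul hΩ h'.locInt),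
    integral_add (hφ.integrableOn_mul hΩ h.locInt_partial)
      (hφ.integrableOn_mul hΩ h'.locInt_partial), h.integral_eq φ hφ, h'.integral_eq φ hφ]
  ring

/-- Leibniz rule, obtained by testing the weak derivative of `f` against `a φ`, which is again a
test function. -/
theorem smooth_mul {a : Pt d → ℝ} (ha : ContDiff ℝ ∞ a) (hΩ : IsOpen Ω)
    (h : HasWeakPartial Ω i f g) :
    HasWeakPartial Ω i (fun x => a x * f x)
      fun x => fderiv ℝ a x (basisVec i) * f x + a x * g x := by
  have ha' : ContDiff ℝ ∞ fun x => fderiv ℝ a x (basisVec i) :=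
    (ha.fderiv_right (m := ∞) (by simp)).clm_apply contDiff_const
  refine ⟨locallyIntegrableOn_mul_smooth ha hΩ h.locInt,
    (locallyIntegrableOn_mul_smooth ha' hΩ h.locInt).add
      (locallyIntegrableOn_mul_smooth ha hΩ h.locInt_partial), fun φ hφ => ?_⟩
  have e := h.integral_eq _ (hφ.smooth_mul ha)
  have i1 := (hφ.smooth_mul ha').integrableOn_mul hΩ h.locInt
  have i2 := (hφ.smooth_mul ha).integrableOn_mul hΩ h.locInt_partial
  have i3 := ((hφ.smooth_mul ha).partialDeriv i).integrableOn_mul hΩ h.locInt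
  have e1 : ∀ x, a x * f x * fderiv ℝ φ x (basisVec i) =
      f x * fderiv ℝ (fun x => a x * φ x) x (basisVec i) -
        f x * (fderiv ℝ a x (basisVec i) * φ x) := by
    intro x
    rw [hφ.fderiv_mul_left ha]
    ring
  have e2 : ∀ x, (fderiv ℝ a x (basisVec i) * f x + a x * g x) * φ x =
      f x * (fderiv ℝ a x (basisVec i) * φ x) + g x * (a x * φ x) := fun x => by ring
  simp only [e1, e2]
  rw [integral_sub i3 i1, integral_add i1 i2, e]
  ring

theorem const_one (i : Fin d) :
    HasWeakPartial Ω i (fun _ => (1 : ℝ)) fun _ => 0 := by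
  refine ⟨locallyIntegrableOn_const _, locallyIntegrableOn_const _, fun φ hφ => ?_⟩
  have h := integral_mul_fderiv_eq_neg_fderiv_mul_of_integrable (𝕜 := ℝ) (μ := volume)
    (f := fun _ : Pt d => (1 : ℝ)) (g := φ) (v := basisVec i) (by simp)
    (by simpa using (hφ.continuous_partial i).integrable_of_hasCompactSupport (hφ.compact_partial i))
    (by simpa using hφ.smooth.continuous.integrable_of_hasCompactSupport hφ.compact)
    (fun x _ => by fun_prop) (fun x _ => hφ.smooth.differentiable (by simp) x)
  have h2 := setIntegral_mul_of_tsupport_subset (f := fun _ => (1 : ℝ)) MeasurableSet.univ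
    (Set.subset_univ Ω) (hφ.tsupport_partial i)
  rw [Measure.restrict_univ] at h2
  rw [h2, h]
  simp

theorem of_smooth {a : Pt d → ℝ} (ha : ContDiff ℝ ∞ a) (hΩ : IsOpen Ω) (i : Fin d) :
    HasWeakPartial Ω i a fun x => fderiv ℝ a x (basisVec i) := by
  simpa using (const_one i).smooth_mul ha hΩ

/-- The fundamental lemma of the calculus of variations, applied to `g - g'`. -/
theorem ae_unique (hΩ : IsOpen Ω) (h : HasWeakPartial Ω i f g)
    (h' : HasWeakPartial Ω i f g') : g =ᵐ[volume.restrict Ω] g' := by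
  have key := hΩ.ae_eq_zero_of_integral_contDiff_smul_eq_zero (μ := volume)
    (f := fun x => g x - g' x) (h.locInt_partial.sub h'.locInt_partial) (fun φ hφ hc hs => by
      have hφ' : IsTestFun Ω φ := ⟨hφ, hc, hs⟩
      have e1 := h.integral_eq φ hφ'
      have e2 := h'.integral_eq φ hφ'
      have e3 : ∫ x in Ω, (g x - g' x) * φ x = 0 := by
        simp only [sub_mul]
        rw [integral_sub (hφ'.integrableOn_mul hΩ h.locInt_partial)
          (hφ'.integrableOn_mul hΩ h'.locInt_partial)]
        linarith
      have e4 := setIntegral_mul_of_tsupport_subset (f := fun x => g x - g' x) MeasurableSet.univ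
        (Set.subset_univ Ω) hs
      rw [Measure.restrict_univ] at e4
      rw [← e3, e4]
      exact integral_congr_ae (.of_forall fun x => by simp [mul_comm]))
  rw [Filter.EventuallyEq, ae_restrict_iff' hΩ.measurableSet]
  filter_upwards [key] with x hx hxΩ
  exact sub_eq_zero.1 (hx hxΩ)

/-- Having a given weak partial derivative is a local property. -/
theorem of_locally (hΩ : IsOpen Ω)
    (h : ∀ x ∈ Ω, ∃ V ⊆ Ω, IsOpen V ∧ x ∈ V ∧ HasWeakPartial V i f g) :
    HasWeakPartial Ω i f g := by
  choose! V hVΩ hVo hxV hV using h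
  have hn : ∀ x ∈ Ω, nhdsWithin x Ω = nhdsWithin x (V x) := fun x hx => by
    rw [hΩ.nhdsWithin_eq hx, (hVo x hx).nhdsWithin_eq (hxV x hx)]
  have hf : LocallyIntegrableOn f Ω := fun x hx => hn x hx ▸ (hV x hx).locInt x (hxV x hx)
  have hg : LocallyIntegrableOn g Ω := fun x hx => hn x hx ▸ (hV x hx).locInt_partial x (hxV x hx)
  refine ⟨hf, hg, fun φ hφ => ?_⟩
  obtain ⟨t, htφ, htc⟩ := hφ.compact.isCompact.elim_nhds_subcover V
    fun x hx => (hVo x (hφ.support hx)).mem_nhds (hxV x (hφ.support hx))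
  -- A partition of unity on `tsupport φ` splits `φ` into finitely many test functions `ρ j * φ`,
  -- each supported in one of the sets `V j`.
  obtain ⟨ρ, hρ⟩ := SmoothPartitionOfUnity.exists_isSubordinate (modelWithCornersSelf ℝ (Pt d))
    (isClosed_tsupport φ) (fun x : t => V x) (fun x => hVo x (hφ.support (htφ x x.2)))
    (fun x hx => by simpa using htc hx)
  have hρs : ∀ j, ContDiff ℝ ∞ (ρ j) := fun j => (ρ j).contMDiff.contDiff
  have hT : ∀ j : t, IsTestFun (V j) fun x => ρ j x * φ x := fun j =>
    ⟨(hρs j).mul hφ.smooth, hφ.compact.mul_left,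
      (closure_mono (Function.support_mul_subset_left (ρ j) φ)).trans (hρ j)⟩
  have hsum : ∀ x, φ x = ∑ j, ρ j x * φ x := by
    intro x
    by_cases hx : x ∈ tsupport φ
    · have := ρ.sum_eq_one hx
      rw [finsum_eq_sum_of_fintype] at this
      rw [← Finset.sum_mul, this, one_mul]
    · simp [image_eq_zero_of_notMem_tsupport hx]
  have hsum' : ∀ x, fderiv ℝ φ x (basisVec i) =
      ∑ j, fderiv ℝ (fun x => ρ j x * φ x) x (basisVec i) := by
    intro x
    conv_lhs => rw [show φ = fun x => ∑ j, ρ j x * φ x from funext hsum]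
    rw [fderiv_fun_sum fun j _ => (hT j).smooth.differentiable (by simp) x]
    simp
  have hsub : ∀ j : t, V j ⊆ Ω := fun j => hVΩ j (hφ.support (htφ j j.2))
  have e1 : ∫ x in Ω, f x * fderiv ℝ φ x (basisVec i) =
      ∑ j, ∫ x in Ω, f x * fderiv ℝ (fun x => ρ j x * φ x) x (basisVec i) := by
    rw [← integral_finsetSum _ fun j _ =>
      (((hT j).mono (hsub j)).partialDeriv i).integrableOn_mul hΩ hf]
    simp only [hsum', Finset.mul_sum]
  have e2 : ∫ x in Ω, g x * φ x = ∑ j, ∫ x in Ω, g x * (ρ j x * φ x) := by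
    rw [← integral_finsetSum _ fun j _ => ((hT j).mono (hsub j)).integrableOn_mul hΩ hg]
    refine integral_congr_ae (.of_forall fun x => ?_)
    simp only [← Finset.mul_sum, ← hsum]
  rw [e1, e2, ← Finset.sum_neg_distrib]
  refine Finset.sum_congr rfl fun j _ => ?_
  have := (hV j (hφ.support (htφ j j.2))).integral_eq _ (hT j)
  rwa [setIntegral_mul_of_tsupport_subset hΩ.measurableSet (hsub j) ((hT j).tsupport_partial i),
    setIntegral_mul_of_tsupport_subset hΩ.measurableSet (hsub j) (hT j).support] at this

/-- A Lipschitz function has its line derivatives as weak partial derivatives. -/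
theorem of_lipschitzWith {C : NNReal} (hf : LipschitzWith C f) (i : Fin d) :
    HasWeakPartial Ω i f fun x => lineDeriv ℝ f x (basisVec i) := by
  have hm : Measurable fun x => lineDeriv ℝ f x (basisVec i) :=
    measurable_lineDeriv hf.continuous
  refine ⟨hf.continuous.locallyIntegrable.locallyIntegrableOn _, ?_, fun φ hφ => ?_⟩
  · refine (LocallyIntegrable.mono (locallyIntegrable_const (C * ‖(basisVec i : Pt d)‖ : ℝ))
      hm.aestronglyMeasurable (.of_forall fun x => ?_)).locallyIntegrableOn _
    exact (norm_lineDeriv_le_of_lipschitz ℝ hf).trans (le_abs_self _)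
  · obtain ⟨D, hD⟩ := (hφ.smooth.of_le (by simp)).lipschitzWith_of_hasCompactSupport
      hφ.compact (by simp : (1 : WithTop ℕ∞) ≠ 0)
    have key := hf.integral_lineDeriv_mul_eq (μ := volume) hD hφ.compact (basisVec i)
    have e1 := setIntegral_mul_of_tsupport_subset (f := f) MeasurableSet.univ
      (Set.subset_univ Ω) (hφ.tsupport_partial i)
    have e2 := setIntegral_mul_of_tsupport_subset (f := fun x => lineDeriv ℝ f x (basisVec i))
      MeasurableSet.univ (Set.subset_univ Ω) hφ.support
    rw [Measure.restrict_univ] at e1 e2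
    rw [e1, e2, key, ← integral_neg]
    refine integral_congr_ae (.of_forall fun x => ?_)
    simp only
    rw [(hφ.smooth.differentiable (by simp) x).lineDeriv_eq_fderiv]
    simp [mul_comm]

/-- A locally Lipschitz function has its line derivatives as weak partial derivatives. -/
theorem of_locally_lipschitz (hΩ : IsOpen Ω)
    (hf : ∀ x ∈ Ω, ∃ V ⊆ Ω, IsOpen V ∧ x ∈ V ∧ ∃ C : NNReal, LipschitzOnWith C f V) :
    HasWeakPartial Ω i f fun x => lineDeriv ℝ f x (basisVec i) := by
  refine of_locally hΩ fun x hx => ?_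
  obtain ⟨V, hVΩ, hVo, hxV, C, hC⟩ := hf x hx
  obtain ⟨F, hF, hFf⟩ := hC.extend_real
  refine ⟨V, hVΩ, hVo, hxV, (of_lipschitzWith hF i).congr ?_ ?_⟩
  · exact (ae_restrict_mem hVo.measurableSet).mono fun y hy => (hFf hy).symm
  · filter_upwards [ae_restrict_mem hVo.measurableSet] with y hy
    exact (Filter.EventuallyEq.lineDeriv_eq (Filter.mem_of_superset (hVo.mem_nhds hy)
      fun w hw => (hFf hw).symm))

end HasWeakPartial

/-! ### The spaces `H^{m,∞}(Ω)` -/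

namespace MemSobolevInf

theorem memLp : ∀ {m : ℕ}, MemSobolevInf Ω m f → MemLp f ∞ (volume.restrict Ω)
  | 0, h => h
  | _ + 1, h => h.1

theorem of_succ : ∀ {m : ℕ} {f : Pt d → ℝ}, MemSobolevInf Ω (m + 1) f → MemSobolevInf Ω m f
  | 0, _, h => h.1
  | _ + 1, _, h => ⟨h.1, fun i => by
      obtain ⟨g, hg, hg'⟩ := h.2 i
      exact ⟨g, hg, hg'.of_succ⟩⟩

theorem of_le {m n : ℕ} (hmn : m ≤ n) (h : MemSobolevInf Ω n f) : MemSobolevInf Ω m f := by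
  induction hmn with
  | refl => exact h
  | step _ ih => exact ih h.of_succ

theorem add (hΩ : IsOpen Ω) : ∀ {m : ℕ} {f g : Pt d → ℝ}, MemSobolevInf Ω m f →
    MemSobolevInf Ω m g → MemSobolevInf Ω m fun x => f x + g x
  | 0, _, _, hf, hg => MemLp.add hf hg
  | _ + 1, _, _, hf, hg => ⟨hf.1.add hg.1, fun i => by
      obtain ⟨u, hu, hu'⟩ := hf.2 i
      obtain ⟨v, hv, hv'⟩ := hg.2 i
      exact ⟨_, hu.add hΩ hv, hu'.add hΩ hv'⟩⟩

theorem _root_.StrainEnergy.memLp_top_of_continuous {a : Pt d → ℝ} (ha : Continuous a)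
    (hΩ : IsOpen Ω) (hb : Bornology.IsBounded Ω) : MemLp a ∞ (volume.restrict Ω) := by
  obtain ⟨C, hC⟩ := (hb.isCompact_closure.image ha).isBounded.exists_norm_le
  refine memLp_top_of_bound ha.aestronglyMeasurable C ?_
  filter_upwards [ae_restrict_mem hΩ.measurableSet] with x hx
  exact hC _ ⟨x, subset_closure hx, rfl⟩

/-- Induction on the order through the Leibniz rule; boundedness of `Ω` makes each derivative of `a`
bounded on it. -/
theorem smooth_mul (hΩ : IsOpen Ω) (hb : Bornology.IsBounded Ω) : ∀ {m : ℕ} {a f : Pt d → ℝ},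
    ContDiff ℝ ∞ a → MemSobolevInf Ω m f → MemSobolevInf Ω m fun x => a x * f x
  | 0, _, _, ha, hf => MemLp.mul (p := ∞) (q := ∞) (hf : MemLp _ _ _)
      (memLp_top_of_continuous ha.continuous hΩ hb)
  | _ + 1, _, _, ha, hf => ⟨MemLp.mul (p := ∞) (q := ∞) hf.1
      (memLp_top_of_continuous ha.continuous hΩ hb), fun i => by
      obtain ⟨u, hu, hu'⟩ := hf.2 i
      exact ⟨_, hu.smooth_mul ha hΩ, (smooth_mul hΩ hb
        ((ha.fderiv_right (m := ∞) (by simp)).clm_apply contDiff_const) hf.of_succ).add hΩ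
        (smooth_mul hΩ hb ha hu')⟩⟩

end MemSobolevInf

/-! ### Elements of `H¹(Ω)` -/

theorem H1.hasWeakPartial (u : H1 Ω) (i : Fin d) : HasWeakPartial Ω i (val u) (weakGrad u i) :=
  u.2 i

theorem H1.ext_val (hΩ : IsOpen Ω) {u v : H1 Ω} (h : val u = val v) : u = v := by
  have hg : ∀ i, weakGrad u i = weakGrad v i := fun i =>
    Lp.ext ((H1.hasWeakPartial u i).ae_unique hΩ (h ▸ H1.hasWeakPartial v i))
  refine Subtype.ext (WithLp.ofLp_injective 2 (Prod.ext h ?_))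
  exact PiLp.ext hg

theorem H1.exists_of_memLp {G : Fin d → Pt d → ℝ} (hf : MemLp f 2 (volume.restrict Ω))
    (hG : ∀ i, MemLp (G i) 2 (volume.restrict Ω)) (h : ∀ i, HasWeakPartial Ω i f (G i)) :
    ∃ u : H1 Ω, val u =ᵐ[volume.restrict Ω] f ∧
      ∀ i, weakGrad u i =ᵐ[volume.restrict Ω] G i := by
  refine ⟨⟨WithLp.toLp 2 (hf.toLp f, WithLp.toLp 2 fun i => (hG i).toLp (G i)), fun i => ?_⟩,
    hf.coeFn_toLp, fun i => (hG i).coeFn_toLp⟩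
  exact (h i).congr hf.coeFn_toLp.symm (hG i).coeFn_toLp.symm

/-- The weak gradient is unique, so the choice made in `ofFun` is immaterial. Everything about
`dotField` passes through this. -/
theorem ofFun_eq (hΩ : IsOpen Ω) {u : H1 Ω} (h : val u =ᵐ[volume.restrict Ω] f) :
    ofFun Ω f = u := by
  have hex : ∃ u : H1 Ω, val u =ᵐ[volume.restrict Ω] f := ⟨u, h⟩
  rw [ofFun, dif_pos hex]
  exact H1.ext_val hΩ (Lp.ext (hex.choose_spec.trans h.symm))

theorem val_add (u v : H1 Ω) : val (u + v) = val u + val v := rfl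

theorem val_smul (c : ℝ) (u : H1 Ω) : val (c • u) = c • val u := rfl

theorem val_sub (u v : H1 Ω) : val (u - v) = val u - val v := rfl

theorem weakGrad_sub (u v : H1 Ω) (i : Fin d) :
    weakGrad (u - v) i = weakGrad u i - weakGrad v i := rfl

theorem H1.norm_le (u : H1 Ω) : ‖u‖ ≤ ‖val u‖ + ∑ i, ‖weakGrad u i‖ := by
  have h1 : ‖u‖ ^ 2 = ‖val u‖ ^ 2 + ∑ i, ‖weakGrad u i‖ ^ 2 := by
    have := WithLp.prod_norm_sq_eq_of_L2 u.1
    rw [PiLp.norm_sq_eq_of_L2] at this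
    exact this
  have h2 : ∑ i, ‖weakGrad u i‖ ^ 2 ≤ (∑ i, ‖weakGrad u i‖) ^ 2 :=
    Finset.sum_sq_le_sq_sum_of_nonneg fun i _ => norm_nonneg _
  have h3 : 0 ≤ ∑ i, ‖weakGrad u i‖ := Finset.sum_nonneg fun i _ => norm_nonneg _
  refine abs_le_of_sq_le_sq' ?_ (by positivity) |>.2
  nlinarith [norm_nonneg (val u)]

end StrainEnergy

end

noncomputable section

namespace StrainEnergy

variable {d : ℕ} {Ω U : Set (Pt d)} {i : Fin d} {f : Pt d → ℝ} {g : Fin d → Pt d → ℝ}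

/-! ### Functions with bounded weak gradient -/

open scoped Convolution Topology

open ContinuousLinearMap in
-- The reflected bump `t ↦ η (x - t)` is a test function on `Ω`, so the derivative of the
-- mollification at `x` is the average of `g` against a nonnegative kernel of mass one.
theorem abs_fderiv_mollification_le {M : ℝ} (hΩ : IsOpen Ω) {g : Pt d → ℝ} {f₀ : Pt d → ℝ}
    (hf₀ : LocallyIntegrable f₀) (hff₀ : Set.EqOn f₀ f Ω) (h : HasWeakPartial Ω i f g)
    (hg : ∀ᵐ x ∂volume.restrict Ω, |g x| ≤ M) (ψ : ContDiffBump (0 : Pt d)) {x : Pt d}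
    (hx : Metric.closedBall x ψ.rOut ⊆ Ω) :
    |fderiv ℝ (ψ.normed volume ⋆[lsmul ℝ ℝ, volume] f₀) x (basisVec i)| ≤ M := by
  set η : Pt d → ℝ := ψ.normed volume with hη
  have hηs : ContDiff ℝ ∞ η := ψ.contDiff_normed
  have hηc : HasCompactSupport η := ψ.hasCompactSupport_normed
  have hd := hηc.hasFDerivAt_convolution_right (lsmul ℝ ℝ (E := ℝ)).flip hf₀
    (hηs.of_le (by simp)) x
  rw [convolution_flip] at hd
  rw [hd.fderiv, convolution_precompR_apply _ hf₀ (hηc.fderiv ℝ)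
    (hηs.continuous_fderiv (by simp)), convolution_def]
  set τ : Pt d → ℝ := fun t => η (x - t) with hτ
  have hsupp : tsupport τ ⊆ Metric.closedBall x ψ.rOut := by
    refine closure_minimal (fun t ht => ?_) Metric.isClosed_closedBall
    have h1 : x - t ∈ Function.support η := ht
    rw [hη, ψ.support_normed_eq] at h1
    rw [Metric.mem_closedBall, dist_eq_norm, norm_sub_rev]
    exact (mem_ball_zero_iff.1 h1).le
  have hτt : IsTestFun Ω τ := ⟨hηs.comp (contDiff_const.sub contDiff_id),
    (isCompact_closedBall x ψ.rOut).of_isClosed_subset (isClosed_tsupport _) hsupp,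
    hsupp.trans hx⟩
  have hτd : ∀ t, fderiv ℝ τ t (basisVec i) = -fderiv ℝ η (x - t) (basisVec i) := by
    intro t
    have h1 : HasFDerivAt τ ((fderiv ℝ η (x - t)).comp (-ContinuousLinearMap.id ℝ (Pt d))) t :=
      (hηs.differentiable (by simp) (x - t)).hasFDerivAt.comp t ((hasFDerivAt_id t).const_sub x)
    rw [h1.fderiv]
    simp
  have e1 : ∫ t, ((lsmul ℝ ℝ (E := ℝ)).flip (f₀ t)) (fderiv ℝ η (x - t) (basisVec i)) =
      ∫ t in Ω, g t * τ t := by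
    have e2 := setIntegral_mul_of_tsupport_subset (f := f₀) MeasurableSet.univ
      (Set.subset_univ Ω) (hτt.tsupport_partial i)
    rw [Measure.restrict_univ] at e2
    have e3 : ∫ t in Ω, f₀ t * fderiv ℝ τ t (basisVec i) =
        ∫ t in Ω, f t * fderiv ℝ τ t (basisVec i) :=
      setIntegral_congr_fun hΩ.measurableSet fun t ht => by simp only [hff₀ ht]
    rw [h.integral_eq τ hτt] at e3
    rw [e3] at e2
    rw [← neg_neg (∫ t in Ω, g t * τ t), e2, ← integral_neg]
    refine integral_congr_ae (.of_forall fun t => ?_)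
    simp only [hτd]
    simp [mul_comm]
  rw [e1]
  have hτ0 : ∀ t, 0 ≤ τ t := fun t => ψ.nonneg_normed _
  have hτ1 : ∫ t in Ω, τ t = 1 := by
    have e2 := setIntegral_mul_of_tsupport_subset (f := fun _ => (1 : ℝ)) MeasurableSet.univ
      (Set.subset_univ Ω) hτt.support
    rw [Measure.restrict_univ] at e2
    simp only [one_mul] at e2
    rw [e2, hτ, integral_sub_left_eq_self η volume x]
    exact ψ.integral_normed
  calc |∫ t in Ω, g t * τ t| ≤ ∫ t in Ω, M * τ t := by
        rw [← Real.norm_eq_abs]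
        refine norm_integral_le_of_norm_le ?_ ?_
        · exact ((hτt.smooth.continuous.integrable_of_hasCompactSupport hτt.compact).const_mul
            M).integrableOn
        · filter_upwards [hg] with t ht
          rw [norm_mul, Real.norm_of_nonneg (hτ0 t)]
          exact mul_le_mul_of_nonneg_right ht (hτ0 t)
    _ = M := by rw [integral_const_mul, hτ1, mul_one]

theorem opNorm_le_of_basisVec {M : ℝ} (hM : 0 ≤ M) (L : Pt d →L[ℝ] ℝ)
    (h : ∀ i, |L (basisVec i)| ≤ M) : ‖L‖ ≤ d * M := by
  refine L.opNorm_le_bound (by positivity) fun v => ?_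
  have hv : v = ∑ i, v i • (basisVec i : Pt d) := by
    ext j
    simp [Finset.sum_apply, Pi.single_apply]
  calc ‖L v‖ = ‖∑ i, v i * L (basisVec i)‖ := by
        conv_lhs => rw [hv]
        simp
    _ ≤ ∑ i, ‖v i * L (basisVec i)‖ := norm_sum_le _ _
    _ ≤ ∑ _i : Fin d, M * ‖v‖ := Finset.sum_le_sum fun i _ => by
        rw [norm_mul, mul_comm]
        exact mul_le_mul (h i) (PiLp.norm_apply_le v i) (norm_nonneg _) hM
    _ = d * M * ‖v‖ := by simp [mul_assoc]

/-- An integrable function with bounded weak gradient has a representative that is Lipschitz on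
convex subsets, with a uniform constant. -/
theorem exists_lipschitz_representative {M : NNReal} (hΩ : IsOpen Ω) (hf : IntegrableOn f Ω)
    (h : ∀ i, HasWeakPartial Ω i f (g i))
    (hg : ∀ i, ∀ᵐ x ∂volume.restrict Ω, |g i x| ≤ M) :
    ∃ F : Pt d → ℝ, F =ᵐ[volume.restrict Ω] f ∧
      ∀ U ⊆ Ω, IsOpen U → Convex ℝ U → LipschitzOnWith (d * M) F U := by
  set f₀ : Pt d → ℝ := Ω.indicator f with hf₀
  have hloc : LocallyIntegrable f₀ :=
    ((integrable_indicator_iff hΩ.measurableSet).2 hf).locallyIntegrable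
  have heq : Set.EqOn f₀ f Ω := Set.eqOn_indicator
  -- The radii shrink to zero at the fixed ratio `2`, as required for almost everywhere convergence
  -- of the mollifications.
  let ψ : ℕ → ContDiffBump (0 : Pt d) := fun n =>
    ⟨1 / (n + 1), 2 * (1 / (n + 1)), by positivity, by
      have : (0 : ℝ) < 1 / (n + 1) := by positivity
      linarith⟩
  have hψ : Filter.Tendsto (fun n => (ψ n).rOut) Filter.atTop (𝓝 0) := by
    have := (tendsto_one_div_add_atTop_nhds_zero_nat (𝕜 := ℝ)).const_mul 2
    rwa [mul_zero] at this
  set F : ℕ → Pt d → ℝ := fun n =>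
    (ψ n).normed volume ⋆[ContinuousLinearMap.lsmul ℝ ℝ, volume] f₀ with hF
  have hconv := ContDiffBump.ae_convolution_tendsto_right_of_locallyIntegrable (μ := volume)
    (φ := ψ) (l := Filter.atTop) (K := 2) hψ (.of_forall fun n => le_rfl) hloc
  set S : Set (Pt d) := {x | Filter.Tendsto (fun n => F n x) Filter.atTop (𝓝 (f₀ x))} with hS
  have hSd : Dense S := Measure.dense_of_ae hconv
  have hlip : ∀ U ⊆ Ω, Convex ℝ U → LipschitzOnWith (d * M) f₀ (S ∩ U) := by
    intro U hU hUc
    refine LipschitzOnWith.of_dist_le_mul fun x hx y hy => ?_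
    have hseg : segment ℝ x y ⊆ Ω := (hUc.segment_subset hx.2 hy.2).trans hU
    have hcomp : IsCompact (segment ℝ x y) := by
      rw [segment_eq_image_lineMap]
      exact isCompact_Icc.image (AffineMap.lineMap_continuous)
    -- The segment keeps a positive distance from the complement of `Ω`; bumps of radius below `δ`
    -- see only `Ω`, and the mean value inequality applies along the segment.
    obtain ⟨δ, hδ, hδΩ⟩ := hcomp.exists_cthickening_subset_open hΩ hseg
    have hev : ∀ᶠ n in Filter.atTop, dist (F n x) (F n y) ≤ (d * M : NNReal) * dist x y := by
      filter_upwards [hψ.eventually (gt_mem_nhds hδ)] with n hn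
      have hdiff : ContDiff ℝ 1 (F n) := (ψ n).hasCompactSupport_normed.contDiff_convolution_left
        _ (ψ n).contDiff_normed hloc
      rw [dist_comm, dist_comm x, dist_eq_norm, dist_eq_norm]
      refine (convex_segment x y).norm_image_sub_le_of_norm_fderiv_le (𝕜 := ℝ)
        (fun w _ => hdiff.differentiable (by simp) w) (fun w hw => ?_)
        (left_mem_segment ℝ x y) (right_mem_segment ℝ x y)
      push_cast
      refine opNorm_le_of_basisVec M.2 _ fun i => ?_
      refine abs_fderiv_mollification_le hΩ hloc heq (h i) (hg i) (ψ n) (Set.Subset.trans ?_ hδΩ)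
      exact (Metric.closedBall_subset_closedBall hn.le).trans
        (Metric.closedBall_subset_cthickening hw δ)
    exact le_of_tendsto (hx.1.dist hy.1) hev
  -- The extension `G` depends on `U`, but on `U` it is the limit of `f₀` along the dense set `S`.
  -- Hence the single function `extendFrom S f₀` serves all `U`.
  have hext : ∀ U ⊆ Ω, IsOpen U → Convex ℝ U → ∃ G : Pt d → ℝ, LipschitzWith (d * M) G ∧
      Set.EqOn f₀ G (S ∩ U) ∧ Set.EqOn (extendFrom S f₀) G U := by
    intro U hU hUo hUc
    obtain ⟨G, hG, hGf⟩ := (hlip U hU hUc).extend_real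
    refine ⟨G, hG, hGf, fun y hy => extendFrom_eq (hSd y) ?_⟩
    refine ((hG.continuous.tendsto y).mono_left nhdsWithin_le_nhds).congr' ?_
    filter_upwards [self_mem_nhdsWithin, nhdsWithin_le_nhds (hUo.mem_nhds hy)] with w hw hw'
    exact (hGf ⟨hw, hw'⟩).symm
  refine ⟨extendFrom S f₀, ?_, fun U hU hUo hUc => ?_⟩
  · filter_upwards [ae_restrict_mem hΩ.measurableSet, ae_restrict_of_ae hconv] with x hx hxS
    obtain ⟨r, hr, hrΩ⟩ := Metric.isOpen_iff.1 hΩ x hx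
    obtain ⟨G, -, hG1, hG2⟩ := hext _ hrΩ Metric.isOpen_ball (convex_ball x r)
    have hxr : x ∈ Metric.ball x r := Metric.mem_ball_self hr
    rw [hG2 hxr, ← hG1 ⟨hxS, hxr⟩, heq hx]
  · obtain ⟨G, hG, -, hG2⟩ := hext U hU hUo hUc
    intro x hx y hy
    rw [hG2 hx, hG2 hy]
    exact hG x y

theorem continuousOn_of_lipschitzOnWith_convex {C : NNReal} (hΩ : IsOpen Ω)
    (h : ∀ U ⊆ Ω, IsOpen U → Convex ℝ U → LipschitzOnWith C f U) : ContinuousOn f Ω := by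
  intro x hx
  obtain ⟨r, hr, hrΩ⟩ := Metric.isOpen_iff.1 hΩ x hx
  exact ((h _ hrΩ Metric.isOpen_ball (convex_ball x r)).continuousOn.continuousAt
    (Metric.ball_mem_nhds x hr)).continuousWithinAt

/-- On a connected open set a function with vanishing weak gradient is constant. -/
theorem ae_eq_const_of_hasWeakPartial_zero (hΩ : IsOpen Ω) (hc : IsPreconnected Ω)
    (hf : IntegrableOn f Ω) (h : ∀ i, HasWeakPartial Ω i f fun _ => 0) :
    ∃ c : ℝ, f =ᵐ[volume.restrict Ω] fun _ => c := by
  -- With `M = 0` the representative is constant on every ball in `Ω`; connectedness does the rest.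
  obtain ⟨F, hFf, hF⟩ := exists_lipschitz_representative (M := 0) hΩ hf h (by simp)
  rcases Ω.eq_empty_or_nonempty with rfl | ⟨x₀, hx₀⟩
  · exact ⟨0, by simp [Filter.EventuallyEq]⟩
  refine ⟨F x₀, hFf.symm.trans ?_⟩
  filter_upwards [ae_restrict_mem hΩ.measurableSet] with x hx
  refine hc.induction₂ (fun x y => F x = F y) (fun y hy => ?_)
    (fun _ _ _ _ _ _ => Eq.trans) (fun _ _ _ _ => Eq.symm) hx hx₀
  obtain ⟨r, hr, hrΩ⟩ := Metric.isOpen_iff.1 hΩ y hy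
  have hl := hF _ hrΩ Metric.isOpen_ball (convex_ball y r)
  filter_upwards [nhdsWithin_le_nhds (Metric.ball_mem_nhds y hr)] with w hw
  have := hl.dist_le_mul y (Metric.mem_ball_self hr) w hw
  simpa using this

end StrainEnergy

end

noncomputable section

namespace StrainEnergy

variable {d : ℕ} {Ω U : Set (Pt d)} {i : Fin d} {f : Pt d → ℝ} {g : Fin d → Pt d → ℝ}

/-! ### Rigid motions -/

/-- The affine function `x ↦ b + ∑ j, A j * x j`. -/
def affineFun (A : Fin d → ℝ) (b : ℝ) (x : Pt d) : ℝ := b + ∑ j, A j * x j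

theorem hasFDerivAt_affineFun (A : Fin d → ℝ) (b : ℝ) (x : Pt d) :
    HasFDerivAt (affineFun A b) (∑ j, A j • (EuclideanSpace.proj j : Pt d →L[ℝ] ℝ)) x := by
  have h := ((∑ j, A j • (EuclideanSpace.proj j : Pt d →L[ℝ] ℝ)).hasFDerivAt
    (x := x)).const_add b
  convert! h using 1
  ext y
  simp [affineFun]

theorem contDiff_affineFun (A : Fin d → ℝ) (b : ℝ) : ContDiff ℝ ∞ (affineFun A b) := by
  unfold affineFun
  fun_prop

theorem fderiv_affineFun (A : Fin d → ℝ) (b : ℝ) (x : Pt d) (i : Fin d) :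
    fderiv ℝ (affineFun A b) x (basisVec i) = A i := by
  rw [(hasFDerivAt_affineFun A b x).fderiv]
  simp

theorem IsTestFun.partialDeriv_comm {φ : Pt d → ℝ} (hφ : IsTestFun Ω φ) (j k : Fin d) (x : Pt d) :
    fderiv ℝ (fun x => fderiv ℝ φ x (basisVec k)) x (basisVec j) =
      fderiv ℝ (fun x => fderiv ℝ φ x (basisVec j)) x (basisVec k) := by
  have hd : DifferentiableAt ℝ (fderiv ℝ φ) x :=
    (hφ.smooth.fderiv_right (m := ∞) (by simp)).differentiable (by simp) x
  have e : ∀ w v : Pt d, fderiv ℝ (fun x => fderiv ℝ φ x w) x v = fderiv ℝ (fderiv ℝ φ) x v w := by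
    intro w v
    rw [fderiv_clm_apply hd (by fun_prop)]
    simp
  rw [e, e]
  exact (hφ.smooth.contDiffAt.isSymmSndFDerivAt
    (by simpa using WithTop.coe_le_coe.2 (le_top : (2 : ℕ∞) ≤ ⊤))) _ _

theorem L2.integrableOn (hb : Bornology.IsBounded Ω) (f : L2 Ω) : IntegrableOn f Ω := by
  have : IsFiniteMeasure (volume.restrict Ω) := ⟨by simpa using hb.measure_lt_top⟩
  exact (Lp.memLp f).integrable (by norm_num)

theorem strain_eq_zero {v : H1Vec Ω} (hv : v ∈ rigidMotions Ω) (i j : Fin d) :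
    strain v i j = 0 := by
  have hint : ∀ i j, Integrable (fun x => strain v i j x * strain v i j x) (volume.restrict Ω) :=
    fun i j => (Lp.memLp (strain v i j)).integrable_mul (q := 2) (Lp.memLp (strain v i j))
  have h0 : ∫ x in Ω, ∑ i, ∑ j, strain v i j x * strain v i j x = 0 := hv
  rw [integral_eq_zero_iff_of_nonneg
    (fun x => Finset.sum_nonneg fun i _ => Finset.sum_nonneg fun j _ => mul_self_nonneg _)
    (integrable_finsetSum _ fun i _ => integrable_finsetSum _ fun j _ => hint i j)] at h0
  rw [Lp.eq_zero_iff_ae_eq_zero]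
  filter_upwards [h0] with x hx
  have h1 := (Finset.sum_eq_zero_iff_of_nonneg fun i _ =>
    Finset.sum_nonneg fun j _ => mul_self_nonneg (strain v i j x)).1 hx i (Finset.mem_univ _)
  have h2 := (Finset.sum_eq_zero_iff_of_nonneg fun j _ =>
    mul_self_nonneg (strain v i j x)).1 h1 j (Finset.mem_univ _)
  exact mul_self_eq_zero.1 h2

theorem weakGrad_ae_eq_neg {v : H1Vec Ω} (hv : v ∈ rigidMotions Ω) (i j : Fin d) :
    weakGrad (v i) j =ᵐ[volume.restrict Ω] fun x => -weakGrad (v j) i x := by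
  have h : weakGrad (v i) j = -weakGrad (v j) i := eq_neg_of_add_eq_zero_left (strain_eq_zero hv i j)
  rw [h]
  exact Lp.coeFn_neg _

/-- Let `T i j k = ∫ ∂_j v_i ∂_k φ`. It is symmetric in `j, k` because weak second derivatives
commute, and antisymmetric in `i, j` because the strain vanishes. Alternating the two rules three
times gives `T = -T`. -/
theorem hasWeakPartial_weakGrad_zero {v : H1Vec Ω} (hv : v ∈ rigidMotions Ω) (i j k : Fin d) :
    HasWeakPartial Ω k (weakGrad (v i) j) fun _ => 0 := by
  refine ⟨L2.locallyIntegrableOn _, locallyIntegrableOn_const _, fun φ hφ => ?_⟩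
  have hsymm : ∀ i j k : Fin d, ∫ x in Ω, weakGrad (v i) j x * fderiv ℝ φ x (basisVec k) =
      ∫ x in Ω, weakGrad (v i) k x * fderiv ℝ φ x (basisVec j) := by
    intro i j k
    have e1 := (H1.hasWeakPartial (v i) j).integral_eq _ (hφ.partialDeriv k)
    have e2 := (H1.hasWeakPartial (v i) k).integral_eq _ (hφ.partialDeriv j)
    simp only [hφ.partialDeriv_comm j k] at e1
    linarith
  have hanti : ∀ i j k : Fin d, ∫ x in Ω, weakGrad (v i) j x * fderiv ℝ φ x (basisVec k) =
      -∫ x in Ω, weakGrad (v j) i x * fderiv ℝ φ x (basisVec k) := by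
    intro i j k
    rw [← integral_neg]
    refine integral_congr_ae ((weakGrad_ae_eq_neg hv i j).mono fun x hx => ?_)
    simp only [hx, neg_mul]
  have a1 := hsymm i j k
  have a2 := hanti i k j
  have a3 := hsymm k i j
  have a4 := hanti k j i
  have a5 := hsymm j k i
  have a6 := hanti j i k
  simp only [zero_mul, integral_zero, neg_zero]
  linarith

/-- A vector field with vanishing strain on a bounded domain is affine. -/
theorem exists_affine_of_mem_rigidMotions (hΩ : IsOpen Ω) (hc : IsPreconnected Ω)
    (hb : Bornology.IsBounded Ω) {v : H1Vec Ω} (hv : v ∈ rigidMotions Ω) (i : Fin d) :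
    ∃ (A : Fin d → ℝ) (b : ℝ), val (v i) =ᵐ[volume.restrict Ω] affineFun A b := by
  have hA : ∀ j, ∃ c : ℝ, weakGrad (v i) j =ᵐ[volume.restrict Ω] fun _ => c := fun j =>
    ae_eq_const_of_hasWeakPartial_zero hΩ hc (L2.integrableOn hb _)
      (hasWeakPartial_weakGrad_zero hv i j)
  choose A hA using hA
  have hs := contDiff_affineFun (fun j => -A j) 0
  have hint : IntegrableOn (affineFun (fun j => -A j) 0) Ω :=
    (hs.continuous.continuousOn.integrableOn_compact hb.isCompact_closure).mono_set subset_closure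
  -- Subtracting the linear part, whose coefficients are the constant values of the weak gradient,
  -- leaves a function with zero weak gradient.
  obtain ⟨b, hbv⟩ := ae_eq_const_of_hasWeakPartial_zero hΩ hc
    (f := fun x => val (v i) x + affineFun (fun j => -A j) 0 x)
    ((L2.integrableOn hb (val (v i))).add hint) (fun k => by
      refine ((H1.hasWeakPartial (v i) k).add hΩ (HasWeakPartial.of_smooth hs hΩ k)).congr
        (Filter.EventuallyEq.refl _ _) ?_
      filter_upwards [hA k] with x hx
      rw [hx, fderiv_affineFun]
      ring)
  refine ⟨A, b, ?_⟩
  filter_upwards [hbv] with x hx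
  simp only [affineFun, neg_mul, Finset.sum_neg_distrib, zero_add] at hx ⊢
  linarith

end StrainEnergy

end

noncomputable section

namespace StrainEnergy

variable {d : ℕ} {Ω U : Set (Pt d)} {f : Pt d → ℝ}

/-! ### Piecewise Lipschitz functions -/

/-- A continuous function on a convex set that is Lipschitz on each piece of a finite closed
cover is Lipschitz. -/
theorem lipschitzOnWith_of_finite_cover {E α : Type*} [NormedAddCommGroup E] [NormedSpace ℝ E]
    {U : Set E} {f : E → ℝ} {C : NNReal} (hU : Convex ℝ U) (hf : ContinuousOn f U) {I : Set α}
    (hI : I.Finite) {T : α → Set E} (hT : ∀ s ∈ I, IsClosed (T s)) (hcov : U ⊆ ⋃ s ∈ I, T s)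
    (hL : ∀ s ∈ I, LipschitzOnWith C f (T s ∩ U)) : LipschitzOnWith C f U := by
  refine LipschitzOnWith.of_dist_le_mul fun x hx y hy => ?_
  set γ : ℝ → E := fun t => AffineMap.lineMap x y t with hγ
  have hγc : Continuous γ := AffineMap.lineMap_continuous
  have hγU : ∀ t ∈ Set.Icc (0 : ℝ) 1, γ t ∈ U := fun t ht => hU.lineMap_mem hx hy ht
  have hγd : ∀ s t : ℝ, dist (γ s) (γ t) = dist s t * dist x y := fun s t =>
    dist_lineMap_lineMap x y s t
  have hfγ : ContinuousOn (fun t => f (γ t)) (Set.Icc 0 1) :=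
    hf.comp hγc.continuousOn hγU
  set A : Set ℝ := {t | dist (f x) (f (γ t)) ≤ C * (t * dist x y)} with hA
  -- Continuous induction along the segment. The pieces are merely closed, so the segment may switch
  -- between them infinitely often and cannot be cut into finitely many intervals.
  have hsub : Set.Icc (0 : ℝ) 1 ⊆ A := by
    refine IsClosed.Icc_subset_of_forall_exists_gt ?_ (by simp [hA, hγ]) ?_
    · rw [Set.inter_comm]
      exact isClosed_Icc.isClosed_le
        (continuous_dist.comp_continuousOn (continuousOn_const.prodMk hfγ))
        (by fun_prop : ContinuousOn (fun t : ℝ => C * (t * dist x y)) (Set.Icc 0 1))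
    · rintro t ⟨htA, ht⟩ b hb
      have hfreq : ∃ᶠ τ in nhdsWithin t (Set.Ioi t), ∃ s ∈ I, γ τ ∈ T s := by
        refine Filter.Eventually.frequently ?_
        filter_upwards [Ioc_mem_nhdsGT ht.2] with τ hτ
        simpa using hcov (hγU τ ⟨ht.1.trans hτ.1.le, hτ.2⟩)
      -- By finiteness, one piece is met arbitrarily close to the right of `t`; being closed, it
      -- also contains `γ t`, so its Lipschitz bound carries the estimate past `t`.
      have : ∃ s ∈ I, ∃ᶠ τ in nhdsWithin t (Set.Ioi t), γ τ ∈ T s := by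
        by_contra! hcon
        refine hfreq ?_
        filter_upwards [(Filter.eventually_all_finite hI).2 hcon] with τ hτ
        rintro ⟨s, hs, hs'⟩
        exact hτ s hs hs'
      obtain ⟨s, hs, hfs⟩ := this
      have hts : γ t ∈ T s := by
        refine (hT s hs).mem_of_frequently_of_tendsto hfs ?_
        exact (hγc.tendsto t).mono_left nhdsWithin_le_nhds
      obtain ⟨τ, hτT, hτ⟩ := (hfs.and_eventually
        (Ioc_mem_nhdsGT (lt_min ht.2 (Set.mem_Ioi.1 hb)))).exists
      have hτ1 : τ ≤ 1 := hτ.2.trans (min_le_left _ _)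
      refine ⟨τ, ?_, hτ.1, hτ.2.trans (min_le_right _ _)⟩
      have h1 := (hL s hs).dist_le_mul _ ⟨hts, hγU t ⟨ht.1, ht.2.le⟩⟩ _
        ⟨hτT, hγU τ ⟨ht.1.trans hτ.1.le, hτ1⟩⟩
      rw [hγd, Real.dist_eq t τ, abs_of_neg (sub_neg.2 hτ.1)] at h1
      have htA' : dist (f x) (f (γ t)) ≤ C * (t * dist x y) := htA
      calc dist (f x) (f (γ τ)) ≤ dist (f x) (f (γ t)) + dist (f (γ t)) (f (γ τ)) :=
            dist_triangle _ _ _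
        _ ≤ C * (t * dist x y) + C * (-(t - τ) * dist x y) := add_le_add htA' h1
        _ = C * (τ * dist x y) := by ring
  have h1 := hsub (Set.right_mem_Icc.2 zero_le_one)
  simpa [hA, hγ] using h1

/-! ### Affine functions on simplices -/

theorem affineFun_sum (A : Fin d → ℝ) (b : ℝ) {s : Finset (Pt d)} {w : Pt d → ℝ}
    (hw : ∑ p ∈ s, w p = 1) :
    affineFun A b (∑ p ∈ s, w p • p) = ∑ p ∈ s, w p * affineFun A b p := by
  have h : ∀ j, (∑ p ∈ s, w p • p) j = ∑ p ∈ s, w p * p j := fun j => by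
    simp [Finset.sum_apply]
  simp only [affineFun, h, mul_add, Finset.sum_add_distrib, ← Finset.sum_mul, hw, one_mul,
    Finset.mul_sum]
  congr 1
  rw [Finset.sum_comm]
  exact Finset.sum_congr rfl fun _ _ => Finset.sum_congr rfl fun _ _ => by ring

theorem lipschitzWith_affineFun (A : Fin d → ℝ) (b : ℝ) :
    ∃ C : NNReal, LipschitzWith C (affineFun A b) := by
  refine ⟨‖∑ j, A j • (EuclideanSpace.proj j : Pt d →L[ℝ] ℝ)‖₊, ?_⟩
  refine lipschitzWith_of_nnnorm_fderiv_le (𝕜 := ℝ)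
    (fun x => (hasFDerivAt_affineFun A b x).differentiableAt) fun x => ?_
  rw [(hasFDerivAt_affineFun A b x).fderiv]

/-- The `d + 1` vertices form an affine basis, so the barycentric coordinates weighted by `c` give
the interpolant. -/
theorem exists_affineFun_interpolating {s : Finset (Pt d)}
    (hs : AffineIndependent ℝ ((↑) : s → Pt d)) (hcard : s.card = d + 1) (c : Pt d → ℝ) :
    ∃ (A : Fin d → ℝ) (b : ℝ), ∀ p ∈ s, affineFun A b p = c p := by
  have htop : affineSpan ℝ (Set.range ((↑) : s → Pt d)) = ⊤ := by
    rw [hs.affineSpan_eq_top_iff_card_eq_finrank_add_one]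
    simp [hcard]
  let B : AffineBasis s ℝ (Pt d) := ⟨(↑), hs, htop⟩
  let L : Pt d →ᵃ[ℝ] ℝ := ∑ p : s, c p • B.coord p
  refine ⟨fun i => L.linear (basisVec i), L 0, fun p hp => ?_⟩
  have h1 : L p = c p := by
    have h2 : ∀ q : s, B.coord q p = if q = ⟨p, hp⟩ then 1 else 0 := fun q =>
      B.coord_apply q ⟨p, hp⟩
    let ev : (Pt d →ᵃ[ℝ] ℝ) →+ ℝ := ⟨⟨fun L => L p, rfl⟩, fun _ _ => rfl⟩
    have h3 : L p = ∑ q : s, c q * B.coord q p := map_sum ev _ _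
    rw [h3]
    simp [h2]
  have h3 : p = ∑ i, p i • (basisVec i : Pt d) := by
    ext j
    simp [Finset.sum_apply, Pi.single_apply]
  rw [← h1, affineFun]
  have h4 : L p = L.linear p + L 0 := by
    have := L.map_vadd 0 p
    simpa using this
  rw [h4, add_comm]
  congr 1
  conv_rhs => rw [h3]
  simp [mul_comm]

theorem weights_eq_of_affineIndependent {s : Finset (Pt d)}
    (hs : AffineIndependent ℝ ((↑) : s → Pt d)) {w w' : Pt d → ℝ}
    (h : ∑ p ∈ s, w p = ∑ p ∈ s, w' p) (h' : ∑ p ∈ s, w p • p = ∑ p ∈ s, w' p • p) :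
    ∀ p ∈ s, w p = w' p := by
  intro p hp
  have := (affineIndependent_iff.1 hs) Finset.univ (fun q => w q - w' q)
    (by
      rw [Finset.sum_coe_sort s (fun q => w q - w' q), Finset.sum_sub_distrib, h, sub_self])
    (by
      rw [Finset.sum_coe_sort s (fun q => (w q - w' q) • q)]
      simp only [sub_smul]
      rw [Finset.sum_sub_distrib, h', sub_self]) ⟨p, hp⟩ (Finset.mem_univ _)
  exact sub_eq_zero.1 this

/-! ### Geometry of triangulations -/

namespace Triangulation

variable (𝒯 : Triangulation Ω)

/-- The vertex sets of the cells. -/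
def cellVerts : Set (Finset (Pt d)) := {s ∈ 𝒯.complex.faces | s.card = d + 1}

variable {𝒯}

theorem finite_cellVerts : 𝒯.cellVerts.Finite := 𝒯.finite.subset fun _ h => h.1

theorem convexHull_mem_cells {s : Finset (Pt d)} (hs : s ∈ 𝒯.cellVerts) :
    convexHull ℝ (s : Set (Pt d)) ∈ 𝒯.cells := ⟨s, hs.1, hs.2, rfl⟩

theorem isCompact_convexHull (s : Finset (Pt d)) : IsCompact (convexHull ℝ (s : Set (Pt d))) :=
  s.finite_toSet.isCompact_convexHull ℝ

theorem finite_cells : 𝒯.cells.Finite := by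
  refine (𝒯.finite.image fun s : Finset (Pt d) => convexHull ℝ (s : Set (Pt d))).subset ?_
  rintro T ⟨s, hs, -, rfl⟩
  exact ⟨s, hs, rfl⟩

theorem diam_le_meshSize {T : Set (Pt d)} (hT : T ∈ 𝒯.cells) : Metric.diam T ≤ 𝒯.meshSize :=
  le_csSup (finite_cells.image _).bddAbove ⟨T, hT, rfl⟩

theorem meshSize_nonneg (𝒯 : Triangulation Ω) : 0 ≤ 𝒯.meshSize :=
  Real.sSup_nonneg (by rintro _ ⟨T, -, rfl⟩; exact Metric.diam_nonneg)

theorem isBounded (𝒯 : Triangulation Ω) : Bornology.IsBounded Ω := by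
  have h : IsCompact 𝒯.complex.space := by
    rw [Geometry.SimplicialComplex.space]
    exact 𝒯.finite.isCompact_biUnion fun s _ => isCompact_convexHull s
  rw [𝒯.space_eq] at h
  exact h.isBounded.subset subset_closure

theorem convexHull_subset_closure {s : Finset (Pt d)} (hs : s ∈ 𝒯.complex.faces) :
    convexHull ℝ (s : Set (Pt d)) ⊆ closure Ω :=
  𝒯.space_eq ▸ Geometry.SimplicialComplex.convexHull_subset_space hs

theorem interior_convexHull_subset (hint : interior (closure Ω) = Ω) {s : Finset (Pt d)}
    (hs : s ∈ 𝒯.complex.faces) : interior (convexHull ℝ (s : Set (Pt d))) ⊆ Ω :=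
  (interior_mono (convexHull_subset_closure hs)).trans hint.subset

theorem volume_convexHull_eq_zero {s : Finset (Pt d)} (hs : s ∈ 𝒯.complex.faces)
    (hcard : s.card ≠ d + 1) : volume (convexHull ℝ (s : Set (Pt d))) = 0 := by
  have htop : affineSpan ℝ (s : Set (Pt d)) ≠ ⊤ := by
    intro h
    have h1 := (𝒯.complex.indep hs).affineSpan_eq_top_iff_card_eq_finrank_add_one
    simp only [Subtype.range_coe_subtype, Finset.setOfPred_mem, h, true_iff] at h1
    simp at h1
    exact hcard h1
  exact measure_mono_null (convexHull_subset_affineSpan _)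
    (Measure.addHaar_affineSubspace volume _ htop)

/-- The cells of a triangulation cover the domain. -/
theorem exists_mem_cell (hΩ : IsOpen Ω) {x : Pt d} (hx : x ∈ Ω) :
    ∃ s ∈ 𝒯.cellVerts, x ∈ convexHull ℝ (s : Set (Pt d)) := by
  by_contra! hcon
  set C : Set (Pt d) := ⋃ s ∈ 𝒯.cellVerts, convexHull ℝ (s : Set (Pt d)) with hC
  have hCc : IsClosed C :=
    (finite_cellVerts.isCompact_biUnion fun s _ => isCompact_convexHull s).isClosed
  have hxC : x ∈ Ω \ C := ⟨hx, by simpa [hC] using hcon⟩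
  -- What the cells miss lies in finitely many lower-dimensional faces, hence is null; being open,
  -- it is empty.
  have hnull : volume (Ω \ C) = 0 := by
    refine measure_mono_null (t := ⋃ s ∈ {s ∈ 𝒯.complex.faces | s.card ≠ d + 1},
      convexHull ℝ (s : Set (Pt d))) ?_ ?_
    · rintro y ⟨hy, hyC⟩
      have : y ∈ 𝒯.complex.space := 𝒯.space_eq ▸ subset_closure hy
      obtain ⟨s, hs, hys⟩ := Geometry.SimplicialComplex.mem_space_iff.1 this
      refine Set.mem_biUnion (x := s) ⟨hs, fun hcard => hyC ?_⟩ hys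
      exact Set.mem_biUnion (x := s) ⟨hs, hcard⟩ hys
    · rw [measure_biUnion_null_iff (𝒯.finite.subset fun _ h => h.1).countable]
      exact fun s hs => volume_convexHull_eq_zero hs.1 hs.2
  have hempty := (hΩ.sdiff hCc).measure_eq_zero_iff volume |>.1 hnull
  rw [hempty] at hxC
  exact hxC

/-- Two faces that share a point `x` share the face spanned by the vertices with positive
weight in `x`. -/
theorem subset_of_mem_convexHull {t s : Finset (Pt d)} (ht : t ∈ 𝒯.complex.faces)
    (hs : s ∈ 𝒯.complex.faces) {w : Pt d → ℝ} (hw : ∀ p ∈ t, 0 < w p) (hw1 : ∑ p ∈ t, w p = 1)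
    (hx : ∑ p ∈ t, w p • p ∈ convexHull ℝ (s : Set (Pt d))) : t ⊆ s := by
  classical
  have hxt : ∑ p ∈ t, w p • p ∈ convexHull ℝ (t : Set (Pt d)) :=
    Finset.mem_convexHull'.2 ⟨w, fun p hp => (hw p hp).le, hw1, rfl⟩
  have hxi := 𝒯.complex.inter_subset_convexHull ht hs ⟨hxt, hx⟩
  rw [← Finset.coe_inter, Finset.mem_convexHull'] at hxi
  obtain ⟨w', hw'0, hw'1, hw'x⟩ := hxi
  -- The point lies in the hull of `t ∩ s`; extending those weights by zero gives a second set of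
  -- weights on `t`. Uniqueness excludes positive weight outside `s`.
  have key := weights_eq_of_affineIndependent (𝒯.complex.indep ht) (w := w)
    (w' := fun p => if p ∈ s then w' p else 0)
    (by rw [hw1, ← hw'1, ← Finset.filter_mem_eq_inter, Finset.sum_filter])
    (by
      rw [← hw'x, ← Finset.filter_mem_eq_inter, Finset.sum_filter]
      exact Finset.sum_congr rfl fun p _ => by split_ifs <;> simp)
  intro p hp
  by_contra hps
  have := key p hp
  simp only [hps, if_false] at this
  exact (hw p hp).ne' this

/-- If `x ∈ Ω` lies in the relative interior of a face, then the segment from `x` to a vertex of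
that face stays in `Ω`, except possibly for the vertex. -/
theorem lineMap_mem (hΩ : IsOpen Ω) (hint : interior (closure Ω) = Ω) {t : Finset (Pt d)}
    (ht : t ∈ 𝒯.complex.faces) {w : Pt d → ℝ} (hw : ∀ p ∈ t, 0 < w p) (hw1 : ∑ p ∈ t, w p = 1)
    {x : Pt d} (hx : ∑ p ∈ t, w p • p = x) (hxΩ : x ∈ Ω) {p : Pt d} (hp : p ∈ t) {τ : ℝ}
    (hτ : τ ∈ Set.Ico (0 : ℝ) 1) : AffineMap.lineMap x p τ ∈ Ω := by
  -- Near `x` only faces containing `x` occur, and each of them has `p` as a vertex.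
  set C : Set (Pt d) := ⋃ s ∈ {s ∈ 𝒯.complex.faces | x ∉ convexHull ℝ (s : Set (Pt d))},
    convexHull ℝ (s : Set (Pt d)) with hC
  have hCc : IsClosed C := ((𝒯.finite.subset fun _ h => h.1).isCompact_biUnion
    fun s _ => isCompact_convexHull s).isClosed
  have hxC : x ∈ Ω \ C := ⟨hxΩ, by simp [hC]⟩
  obtain ⟨r, hr, hball⟩ := Metric.isOpen_iff.1 (hΩ.sdiff hCc) x hxC
  have hτ' : 0 < 1 - τ := by linarith [hτ.2]
  have hτn : (1 - τ) ≠ 0 := hτ'.ne'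
  set y : Pt d := AffineMap.lineMap x p τ with hy
  rw [← hint, mem_interior]
  refine ⟨Metric.ball y ((1 - τ) * r), fun z hz => ?_, Metric.isOpen_ball,
    Metric.mem_ball_self (by positivity)⟩
  -- The homothety with centre `p` and ratio `1 - τ` takes `u` to `z` and the ball about `x` to the
  -- ball about `y`. A face containing `u` and `p` contains `z`, so this whole ball lies in `closure
  -- Ω`.
  set u : Pt d := x + (1 - τ)⁻¹ • (z - y) with hu
  have hub : u ∈ Metric.ball x r := by
    rw [Metric.mem_ball, dist_eq_norm] at hz ⊢
    rw [hu, add_sub_cancel_left, norm_smul, Real.norm_of_nonneg (by positivity),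
      inv_mul_lt_iff₀ hτ']
    exact hz
  have hzu : z = (1 - τ) • u + τ • p := by
    rw [hu, smul_add, smul_smul, mul_inv_cancel₀ hτn, one_smul, hy, AffineMap.lineMap_apply_module]
    abel
  have huΩ := hball hub
  have huS : u ∈ 𝒯.complex.space := 𝒯.space_eq ▸ subset_closure huΩ.1
  obtain ⟨s, hs, hus⟩ := Geometry.SimplicialComplex.mem_space_iff.1 huS
  have hxs : x ∈ convexHull ℝ (s : Set (Pt d)) := by
    by_contra hxs
    exact huΩ.2 (Set.mem_biUnion (x := s) ⟨hs, hxs⟩ hus)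
  have hps : p ∈ s := subset_of_mem_convexHull ht hs hw hw1 (hx ▸ hxs) hp
  refine convexHull_subset_closure hs ?_
  rw [hzu]
  exact convex_convexHull ℝ _ hus (subset_convexHull ℝ _ hps) hτ'.le hτ.1 (by ring)

end Triangulation

end StrainEnergy

end

noncomputable section

namespace StrainEnergy

variable {d : ℕ} {Ω U : Set (Pt d)} {f : Pt d → ℝ}

/-! ### Piecewise affine functions -/

theorem exists_mvPolynomial_eq_affineFun {k : ℕ} (hk : 1 ≤ k) (A : Fin d → ℝ) (b : ℝ) :
    ∃ p : MvPolynomial (Fin d) ℝ, p.totalDegree ≤ k ∧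
      ∀ x : Pt d, affineFun A b x = MvPolynomial.eval (fun i => x i) p := by
  refine ⟨MvPolynomial.C b + ∑ j, MvPolynomial.C (A j) * MvPolynomial.X j, ?_, fun x => ?_⟩
  · refine ((MvPolynomial.totalDegree_add _ _).trans (max_le (by simp) ?_)).trans hk
    refine MvPolynomial.totalDegree_finsetSum_le fun j _ => ?_
    refine (MvPolynomial.totalDegree_mul _ _).trans ?_
    simp
  · simp [affineFun]

theorem affineFun_add_smul (A : Fin d → ℝ) (b : ℝ) (x : Pt d) (r : ℝ) (i : Fin d) :
    affineFun A b (x + r • basisVec i) = affineFun A b x + r * A i := by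
  simp [affineFun, mul_add, Finset.sum_add_distrib]
  ring

namespace Triangulation

variable {𝒯 : Triangulation Ω}

theorem ae_exists_mem_interior (hΩ : IsOpen Ω) : ∀ᵐ x ∂volume.restrict Ω,
    ∃ s ∈ 𝒯.cellVerts, x ∈ interior (convexHull ℝ (s : Set (Pt d))) := by
  have h1 : ∀ᵐ x ∂(volume : Measure (Pt d)), ∀ s ∈ 𝒯.cellVerts,
      x ∉ frontier (convexHull ℝ (s : Set (Pt d))) := by
    rw [ae_ball_iff finite_cellVerts.countable]
    intro s _
    exact measure_eq_zero_iff_ae_notMem.1 ((convex_convexHull ℝ _).addHaar_frontier volume)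
  filter_upwards [ae_restrict_mem hΩ.measurableSet, ae_restrict_of_ae h1] with x hx hx1
  obtain ⟨s, hs, hxs⟩ := exists_mem_cell (𝒯 := 𝒯) hΩ hx
  refine ⟨s, hs, ?_⟩
  by_contra hcon
  exact hx1 s hs ⟨subset_closure hxs, hcon⟩

/-- Compatible affine functions on the cells define an element of the finite element space. -/
theorem exists_mem_feSpace_of_compatible (hΩ : IsOpen Ω) {k : ℕ} (hk : 1 ≤ k)
    {A : Finset (Pt d) → Fin d → ℝ} {b : Finset (Pt d) → ℝ}
    (hcomp : ∀ s ∈ 𝒯.cellVerts, ∀ s' ∈ 𝒯.cellVerts, ∀ x ∈ Ω, x ∈ convexHull ℝ (s : Set (Pt d)) →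
      x ∈ convexHull ℝ (s' : Set (Pt d)) → affineFun (A s) (b s) x = affineFun (A s') (b s') x) :
    ∃ μ ∈ feSpace k 𝒯, ∀ᵐ x ∂volume.restrict Ω, ∀ s ∈ 𝒯.cellVerts,
      x ∈ interior (convexHull ℝ (s : Set (Pt d))) →
        val μ x = affineFun (A s) (b s) x ∧ ∀ i, weakGrad μ i x = A s i := by
  classical
  have hb := 𝒯.isBounded
  have : IsFiniteMeasure (volume.restrict Ω) := ⟨by simpa using hb.measure_lt_top⟩
  have hcov := fun x (hx : x ∈ Ω) => exists_mem_cell (𝒯 := 𝒯) hΩ hx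
  set I : Pt d → ℝ := fun x =>
    if h : ∃ s ∈ 𝒯.cellVerts, x ∈ convexHull ℝ (s : Set (Pt d)) then
      affineFun (A h.choose) (b h.choose) x else 0 with hI
  have hIs : ∀ s ∈ 𝒯.cellVerts, ∀ x ∈ Ω, x ∈ convexHull ℝ (s : Set (Pt d)) →
      I x = affineFun (A s) (b s) x := by
    intro s hs x hx hxs
    have h : ∃ s ∈ 𝒯.cellVerts, x ∈ convexHull ℝ (s : Set (Pt d)) := ⟨s, hs, hxs⟩
    simp only [hI, dif_pos h]
    exact hcomp _ h.choose_spec.1 s hs x hx h.choose_spec.2 hxs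
  obtain ⟨C, hC⟩ : ∃ C : NNReal, ∀ s ∈ 𝒯.cellVerts, LipschitzWith C (affineFun (A s) (b s)) := by
    choose C hC using fun s => lipschitzWith_affineFun (A s) (b s)
    obtain ⟨B, hB⟩ := (finite_cellVerts (𝒯 := 𝒯) |>.image C).bddAbove
    exact ⟨B, fun s hs => (hC s).weaken (hB ⟨s, hs, rfl⟩)⟩
  have hcont : ContinuousOn I Ω := by
    have h1 : ContinuousOn I (⋃ s : 𝒯.cellVerts, convexHull ℝ ((s : Finset (Pt d)) : Set (Pt d)) ∩
        Ω) := by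
      have := finite_cellVerts (𝒯 := 𝒯) |>.to_subtype
      intro x hx
      rw [← Set.iUnion_inter] at hx ⊢
      rw [Set.iUnion_inter, ContinuousWithinAt, nhdsWithin_iUnion, Filter.tendsto_iSup]
      intro s
      by_cases hxs : x ∈ convexHull ℝ ((s : Finset (Pt d)) : Set (Pt d))
      · have h2 : ContinuousWithinAt I
            (convexHull ℝ ((s : Finset (Pt d)) : Set (Pt d)) ∩ Ω) x := by
          refine ((hC s s.2).continuous.continuousWithinAt).congr
            (fun y hy => hIs s s.2 y hy.2 hy.1) (hIs s s.2 x hx.2 hxs)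
        exact h2
      · have h3 : nhdsWithin x (convexHull ℝ ((s : Finset (Pt d)) : Set (Pt d)) ∩ Ω) = ⊥ := by
          rw [← Filter.not_neBot, ← mem_closure_iff_nhdsWithin_neBot]
          exact fun h => hxs ((isCompact_convexHull _).isClosed.closure_subset
            (closure_mono Set.inter_subset_left h))
        rw [h3]
        exact Filter.tendsto_bot
    refine h1.mono fun x hx => ?_
    obtain ⟨s, hs, hxs⟩ := hcov x hx
    exact Set.mem_iUnion.2 ⟨⟨s, hs⟩, hxs, hx⟩
  -- The glued function is Lipschitz on each cell, and continuity on `Ω` upgrades this to convex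
  -- sets crossing several cells.
  have hlip : ∀ V ⊆ Ω, Convex ℝ V → LipschitzOnWith C I V := by
    intro V hV hVc
    refine lipschitzOnWith_of_finite_cover hVc (hcont.mono hV) (finite_cellVerts (𝒯 := 𝒯))
      (T := fun s => convexHull ℝ (s : Set (Pt d)))
      (fun s _ => (isCompact_convexHull s).isClosed) (fun x hx => ?_) fun s hs x hx y hy => ?_
    · obtain ⟨s, hs, hxs⟩ := hcov x (hV hx)
      exact Set.mem_biUnion hs hxs
    · rw [hIs s hs x (hV hx.2) hx.1, hIs s hs y (hV hy.2) hy.1]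
      exact hC s hs x y
  have hweak : ∀ i, HasWeakPartial Ω i I fun x => lineDeriv ℝ I x (basisVec i) := fun i =>
    HasWeakPartial.of_locally_lipschitz hΩ fun x hx => by
      obtain ⟨r, hr, hrΩ⟩ := Metric.isOpen_iff.1 hΩ x hx
      exact ⟨_, hrΩ, Metric.isOpen_ball, Metric.mem_ball_self hr, C, hlip _ hrΩ (convex_ball x r)⟩
  have hder : ∀ s ∈ 𝒯.cellVerts, ∀ x ∈ Ω, x ∈ interior (convexHull ℝ (s : Set (Pt d))) →
      ∀ i, lineDeriv ℝ I x (basisVec i) = A s i := by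
    intro s hs x hx hxs i
    have h1 : I =ᶠ[nhds x] affineFun (A s) (b s) := by
      filter_upwards [isOpen_interior.mem_nhds hxs, hΩ.mem_nhds hx] with y hy hyΩ
      exact hIs s hs y hyΩ (interior_subset hy)
    rw [h1.lineDeriv_eq, ((contDiff_affineFun _ _).differentiable (by simp) x).lineDeriv_eq_fderiv,
      fderiv_affineFun]
  have hI2 : MemLp I 2 (volume.restrict Ω) := by
    choose B hB using fun s : Finset (Pt d) => ((isCompact_convexHull s).image
      (contDiff_affineFun (A s) (b s)).continuous).isBounded.exists_norm_le
    obtain ⟨M, hM⟩ := (finite_cellVerts (𝒯 := 𝒯) |>.image B).bddAbove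
    refine MemLp.of_bound (hcont.aestronglyMeasurable hΩ.measurableSet) M ?_
    filter_upwards [ae_restrict_mem hΩ.measurableSet] with x hx
    obtain ⟨s, hs, hxs⟩ := hcov x hx
    rw [hIs s hs x hx hxs]
    exact (hB s _ ⟨x, hxs, rfl⟩).trans (hM ⟨s, hs, rfl⟩)
  have hG2 : ∀ i, MemLp (fun x => lineDeriv ℝ I x (basisVec i)) 2 (volume.restrict Ω) := by
    intro i
    obtain ⟨M, hM⟩ := (finite_cellVerts (𝒯 := 𝒯) |>.image fun s => ‖A s i‖).bddAbove
    refine MemLp.of_bound (hweak i).locInt_partial.aestronglyMeasurable M ?_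
    filter_upwards [ae_restrict_mem hΩ.measurableSet, ae_exists_mem_interior (𝒯 := 𝒯) hΩ]
      with x hx hxs
    obtain ⟨s, hs, hxs⟩ := hxs
    rw [hder s hs x hx hxs]
    exact hM ⟨s, hs, rfl⟩
  obtain ⟨μ, hμ, hμ'⟩ := H1.exists_of_memLp hI2 hG2 hweak
  refine ⟨μ, ⟨I, hμ, hcont, ?_⟩, ?_⟩
  · rintro T ⟨s, hs, hcard, rfl⟩
    obtain ⟨p, hp, hpe⟩ := exists_mvPolynomial_eq_affineFun hk (A s) (b s)
    exact ⟨p, hp, fun x hx => by rw [hIs s ⟨hs, hcard⟩ x hx.2 hx.1, hpe]⟩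
  · filter_upwards [ae_restrict_mem hΩ.measurableSet, hμ, ae_all_iff.2 hμ'] with x hx h1 h2 s hs hxs
    exact ⟨by rw [h1, hIs s hs x hx (interior_subset hxs)],
      fun i => by rw [h2, hder s hs x hx hxs]⟩

/-- The nodal interpolants, on two cells, of a function that is continuous on `Ω` and extends
continuously to each closed cell coincide at the common points of the cells in `Ω`. -/
theorem affineFun_eq_of_interpolating (hΩ : IsOpen Ω) (hint : interior (closure Ω) = Ω)
    {s s' : Finset (Pt d)} (hs : s ∈ 𝒯.cellVerts) (hs' : s' ∈ 𝒯.cellVerts) {F E E' : Pt d → ℝ}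
    (hE : Continuous E) (hE' : Continuous E')
    (hEF : ∀ x ∈ Ω, x ∈ convexHull ℝ (s : Set (Pt d)) → E x = F x)
    (hEF' : ∀ x ∈ Ω, x ∈ convexHull ℝ (s' : Set (Pt d)) → E' x = F x)
    {A A' : Fin d → ℝ} {b b' : ℝ} (hA : ∀ p ∈ s, affineFun A b p = E p)
    (hA' : ∀ p ∈ s', affineFun A' b' p = E' p) {x : Pt d} (hx : x ∈ Ω)
    (hxs : x ∈ convexHull ℝ (s : Set (Pt d))) (hxs' : x ∈ convexHull ℝ (s' : Set (Pt d))) :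
    affineFun A b x = affineFun A' b' x := by
  classical
  have hxi := 𝒯.complex.inter_subset_convexHull hs.1 hs'.1 ⟨hxs, hxs'⟩
  rw [← Finset.coe_inter, Finset.mem_convexHull'] at hxi
  obtain ⟨w, hw0, hw1, hwx⟩ := hxi
  -- The smallest common face containing `x`. Only its vertices influence the two interpolants at
  -- `x`; at other shared vertices `E` and `E'` need not agree.
  set t : Finset (Pt d) := {p ∈ s ∩ s' | w p ≠ 0} with ht
  have ht1 : ∑ p ∈ t, w p = 1 := by rw [ht, Finset.sum_filter_ne_zero, hw1]
  have htx : ∑ p ∈ t, w p • p = x := by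
    rw [← hwx]
    refine Finset.sum_subset (Finset.filter_subset _ _) fun p hp hpt => ?_
    have : w p = 0 := by
      by_contra h
      exact hpt (Finset.mem_filter.2 ⟨hp, h⟩)
    rw [this, zero_smul]
  have hts : t ⊆ s := (Finset.filter_subset _ _).trans Finset.inter_subset_left
  have hts' : t ⊆ s' := (Finset.filter_subset _ _).trans Finset.inter_subset_right
  have htn : t.Nonempty := by
    by_contra h
    rw [Finset.not_nonempty_iff_eq_empty.1 h] at ht1
    simp at ht1
  have htf := 𝒯.complex.down_closed hs.1 hts htn
  have htw : ∀ p ∈ t, 0 < w p := fun p hp =>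
    lt_of_le_of_ne (hw0 p (Finset.mem_filter.1 hp).1) (Finset.mem_filter.1 hp).2.symm
  -- Along the half-open segment from `x` to `p`, inside `Ω` and both cells, `E` and `E'` both equal
  -- `F`. Their limits at `p` agree, even if `p ∉ Ω`.
  have key : ∀ p ∈ t, E p = E' p := by
    intro p hp
    have hγ : Filter.Tendsto (fun τ : ℝ => AffineMap.lineMap x p τ)
        (nhdsWithin 1 (Set.Iio 1)) (nhds p) := by
      have h1 : Continuous fun τ : ℝ => (AffineMap.lineMap x p τ : Pt d) :=
        AffineMap.lineMap_continuous
      have h2 := h1.tendsto 1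
      simp only [AffineMap.lineMap_apply_one] at h2
      exact h2.mono_left nhdsWithin_le_nhds
    refine tendsto_nhds_unique ((hE.tendsto p).comp hγ) (((hE'.tendsto p).comp hγ).congr' ?_)
    filter_upwards [Ico_mem_nhdsLT (zero_lt_one' ℝ)] with τ hτ
    have hm := lineMap_mem hΩ hint htf htw ht1 htx hx hp hτ
    have hτ' : τ ∈ Set.Icc (0 : ℝ) 1 := ⟨hτ.1, hτ.2.le⟩
    simp only [Function.comp]
    rw [hEF _ hm ((convex_convexHull ℝ _).lineMap_mem hxs (subset_convexHull ℝ _ (hts hp)) hτ'),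
      hEF' _ hm ((convex_convexHull ℝ _).lineMap_mem hxs' (subset_convexHull ℝ _ (hts' hp)) hτ')]
  rw [← htx, affineFun_sum _ _ ht1, affineFun_sum _ _ ht1]
  refine Finset.sum_congr rfl fun p hp => ?_
  rw [hA p (hts hp), hA' p (hts' hp), key p hp]

end Triangulation

/-! ### The interpolation error -/

/-- After subtraction of the Taylor polynomial at `x₀` the gradient is bounded by `C δ`; the
remainder is thus Lipschitz with constant `d C δ` and vanishes at `x₀`. -/
theorem abs_sub_taylor_le (hU : IsOpen U) (hUc : Convex ℝ U) {F : Pt d → ℝ}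
    {G : Fin d → Pt d → ℝ} {C δ : NNReal} (hF : ContinuousOn F U) (hb : Bornology.IsBounded U)
    (hFi : IntegrableOn F U) (hw : ∀ i, HasWeakPartial U i F (G i))
    (hG : ∀ i, LipschitzOnWith C (G i) U) {x₀ : Pt d} (hx₀ : x₀ ∈ U)
    (hδ : ∀ x ∈ U, dist x x₀ ≤ δ) {y : Pt d} (hy : y ∈ U) :
    |F y - affineFun (fun i => G i x₀) (F x₀ - ∑ i, G i x₀ * x₀ i) y| ≤ d * C * δ * δ := by
  set a : Pt d → ℝ := affineFun (fun i => -G i x₀) (∑ i, G i x₀ * x₀ i - F x₀) with ha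
  have has : ContDiff ℝ ∞ a := contDiff_affineFun _ _
  have hai : IntegrableOn a U :=
    (has.continuous.continuousOn.integrableOn_compact hb.isCompact_closure).mono_set subset_closure
  obtain ⟨R, hR, hRl⟩ := exists_lipschitz_representative (M := C * δ) (f := fun x => F x + a x)
    (g := fun i x => G i x + fderiv ℝ a x (basisVec i)) hU (hFi.add hai)
    (fun i => (hw i).add hU (HasWeakPartial.of_smooth has hU i)) (fun i => by
      filter_upwards [ae_restrict_mem hU.measurableSet] with x hx
      rw [ha, fderiv_affineFun, ← sub_eq_add_neg, ← Real.dist_eq]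
      refine ((hG i).dist_le_mul x hx x₀ hx₀).trans ?_
      push_cast
      exact mul_le_mul_of_nonneg_left (hδ x hx) C.2)
  have hRL := hRl U subset_rfl hU hUc
  have heq : Set.EqOn R (fun x => F x + a x) U :=
    Measure.eqOn_open_of_ae_eq hR hU hRL.continuousOn (hF.add has.continuous.continuousOn)
  have h0 : F x₀ + a x₀ = 0 := by
    simp only [ha, affineFun, neg_mul, Finset.sum_neg_distrib]
    ring
  have h1 := hRL.dist_le_mul y hy x₀ hx₀
  rw [heq hy, heq hx₀] at h1
  simp only [h0, Real.dist_0_eq_abs] at h1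
  have h2 : F y - affineFun (fun i => G i x₀) (F x₀ - ∑ i, G i x₀ * x₀ i) y = F y + a y := by
    simp only [ha, affineFun, neg_mul, Finset.sum_neg_distrib]
    ring
  rw [h2]
  refine h1.trans ?_
  push_cast
  rw [← mul_assoc]
  exact mul_le_mul_of_nonneg_left (hδ y hy) (by positivity)

/-- Both errors come from comparison with the Taylor polynomial at `x₀`. The interpolant is within
`ε` of it at the vertices, hence on `T` by convexity. -/
theorem interpolation_error_le {s : Finset (Pt d)} {T : Set (Pt d)}
    (hT : T = convexHull ℝ (s : Set (Pt d))) {F E : Pt d → ℝ} {G : Fin d → Pt d → ℝ} {C : NNReal}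
    {σ r : ℝ} {x₀ : Pt d} (hr : 0 < r) (hball : Metric.closedBall x₀ r ⊆ T)
    (hσ : Metric.diam T ≤ σ * r) (hF : ContinuousOn F (interior T))
    (hFi : IntegrableOn F (interior T)) (hw : ∀ i, HasWeakPartial (interior T) i F (G i))
    (hG : ∀ i, LipschitzOnWith C (G i) (interior T)) (hE : Continuous E)
    (hEF : Set.EqOn F E (interior T)) {A : Fin d → ℝ} {b : ℝ}
    (hA : ∀ p ∈ s, affineFun A b p = E p) {y : Pt d} (hy : y ∈ interior T) :
    |F y - affineFun A b y| ≤ 2 * (d * C * Metric.diam T * Metric.diam T) ∧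
      ∀ i, |G i y - A i| ≤ (C + 2 * (d * C * σ)) * Metric.diam T := by
  have hTb : Bornology.IsBounded T := hT ▸ (Triangulation.isCompact_convexHull s).isBounded
  have hTclosed : IsClosed T := hT ▸ (Triangulation.isCompact_convexHull s).isClosed
  have hTc : Convex ℝ T := hT ▸ convex_convexHull ℝ _
  have hx₀ : x₀ ∈ interior T := mem_interior.2 ⟨Metric.ball x₀ r,
    Metric.ball_subset_closedBall.trans hball, Metric.isOpen_ball, Metric.mem_ball_self hr⟩
  set δ : NNReal := ⟨Metric.diam T, Metric.diam_nonneg⟩ with hδ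
  have hδ' : (δ : ℝ) = Metric.diam T := rfl
  rw [← hδ'] at hσ ⊢
  have hdist : ∀ x ∈ interior T, dist x x₀ ≤ δ := fun x hx =>
    Metric.dist_le_diam_of_mem hTb (interior_subset hx) (interior_subset hx₀)
  set A₀ : Fin d → ℝ := fun i => G i x₀ with hA₀
  set b₀ : ℝ := F x₀ - ∑ i, G i x₀ * x₀ i with hb₀
  set ε : ℝ := d * C * δ * δ with hε
  have htay : ∀ y ∈ interior T, |F y - affineFun A₀ b₀ y| ≤ ε := fun y hy =>
    abs_sub_taylor_le isOpen_interior hTc.interior hF (hTb.subset interior_subset) hFi hw hG hx₀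
      hdist hy
  have hcl : T ⊆ closure (interior T) := by
    rw [hTc.closure_interior_eq_closure_of_nonempty_interior ⟨x₀, hx₀⟩]
    exact subset_closure
  have hEt : ∀ y ∈ T, |E y - affineFun A₀ b₀ y| ≤ ε := by
    intro y hy
    have hcl' : IsClosed {y | |E y - affineFun A₀ b₀ y| ≤ ε} :=
      isClosed_le (hE.sub (contDiff_affineFun A₀ b₀).continuous).abs continuous_const
    refine closure_minimal (fun z hz => ?_) hcl' (hcl hy)
    rw [Set.mem_ofPred_eq, ← hEF hz]
    exact htay z hz
  have hAt : ∀ y ∈ T, |affineFun A b y - affineFun A₀ b₀ y| ≤ ε := by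
    intro y hy
    rw [hT, Finset.mem_convexHull'] at hy
    obtain ⟨w, hw0, hw1, rfl⟩ := hy
    rw [affineFun_sum _ _ hw1, affineFun_sum _ _ hw1, ← Finset.sum_sub_distrib]
    calc |∑ p ∈ s, (w p * affineFun A b p - w p * affineFun A₀ b₀ p)|
        ≤ ∑ p ∈ s, |w p * affineFun A b p - w p * affineFun A₀ b₀ p| :=
          Finset.abs_sum_le_sum_abs _ _
      _ ≤ ∑ p ∈ s, w p * ε := Finset.sum_le_sum fun p hp => by
          rw [← mul_sub, abs_mul, abs_of_nonneg (hw0 p hp), hA p hp]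
          exact mul_le_mul_of_nonneg_left
            (hEt p (hT ▸ subset_convexHull ℝ _ hp)) (hw0 p hp)
      _ = ε := by rw [← Finset.sum_mul, hw1, one_mul]
  constructor
  · have h1 := htay y hy
    have h2 := hAt y (interior_subset hy)
    calc |F y - affineFun A b y|
        = |(F y - affineFun A₀ b₀ y) - (affineFun A b y - affineFun A₀ b₀ y)| := by ring_nf
      _ ≤ |F y - affineFun A₀ b₀ y| + |affineFun A b y - affineFun A₀ b₀ y| := abs_sub _ _
      _ ≤ 2 * ε := by linarith
  · intro i
    have hxr : x₀ + r • basisVec i ∈ T := hball (by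
      rw [Metric.mem_closedBall, dist_eq_norm, add_sub_cancel_left, norm_smul]
      simp [abs_of_pos hr])
    have h1 := hAt _ hxr
    have h2 := hAt x₀ (interior_subset hx₀)
    rw [affineFun_add_smul, affineFun_add_smul] at h1
    -- Shape regularity enters here: an affine function's slope is read off at two points at
    -- distance `r`, and `δ ≤ σ r` absorbs the division by `r`.
    have h3 : r * |A i - A₀ i| ≤ r * (2 * (d * C * σ) * δ) := by
      have h4 : r * |A i - A₀ i| = |r * A i - r * A₀ i| := by
        rw [← mul_sub, abs_mul, abs_of_pos hr]
      have h5 : |r * A i - r * A₀ i| ≤ 2 * ε := by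
        rw [abs_le] at h1 h2 ⊢
        constructor <;> linarith [h1.1, h1.2, h2.1, h2.2]
      have h6 : ε ≤ d * C * δ * (σ * r) := mul_le_mul_of_nonneg_left hσ (by positivity)
      rw [h4]
      linarith
    have h4 : |A i - A₀ i| ≤ 2 * (d * C * σ) * δ := le_of_mul_le_mul_left h3 hr
    have h5 : |G i y - A₀ i| ≤ C * δ := by
      have := (hG i).dist_le_mul y hy x₀ hx₀
      exact this.trans (mul_le_mul_of_nonneg_left (hdist y hy) C.2)
    calc |G i y - A i| = |(G i y - A₀ i) - (A i - A₀ i)| := by ring_nf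
      _ ≤ |G i y - A₀ i| + |A i - A₀ i| := abs_sub _ _
      _ ≤ (C + 2 * (d * C * σ)) * δ := by linarith

end StrainEnergy

end

noncomputable section

namespace StrainEnergy

variable {d : ℕ} {Ω U : Set (Pt d)} {f : Pt d → ℝ}

/-! ### Approximation by finite elements -/

theorem exists_ae_bound_of_memLp_top {α : Type*} [Finite α] {g : α → Pt d → ℝ}
    (hg : ∀ a, MemLp (g a) ∞ (volume.restrict Ω)) :
    ∃ M : NNReal, ∀ a, ∀ᵐ x ∂volume.restrict Ω, |g a x| ≤ M := by
  have h : ∀ a, ∃ M : NNReal, ∀ᵐ x ∂volume.restrict Ω, |g a x| ≤ M := fun a => by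
    refine ⟨(eLpNorm (g a) ∞ (volume.restrict Ω)).toNNReal, ?_⟩
    have h1 := ae_le_eLpNormEssSup (f := g a) (μ := volume.restrict Ω)
    rw [← eLpNorm_exponent_top] at h1
    filter_upwards [h1] with x hx
    rw [← Real.norm_eq_abs, ← coe_nnnorm, NNReal.coe_le_coe]
    exact ENNReal.le_toNNReal_of_coe_le hx (hg a).2.ne
  choose M hM using h
  obtain ⟨B, hB⟩ := (Set.finite_range M).bddAbove
  exact ⟨B, fun a => (hM a).mono fun x hx => hx.trans (by exact_mod_cast hB ⟨a, rfl⟩)⟩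

/-- A function in `H^{2,∞}(Ω)` and its gradient have representatives that are Lipschitz on convex
subsets. -/
theorem MemSobolevInf.exists_representatives (hΩ : IsOpen Ω) (hb : Bornology.IsBounded Ω)
    (hf : MemSobolevInf Ω 2 f) : ∃ (C : NNReal) (F : Pt d → ℝ) (G : Fin d → Pt d → ℝ),
      F =ᵐ[volume.restrict Ω] f ∧ (∀ i, HasWeakPartial Ω i F (G i)) ∧
      (∀ V ⊆ Ω, IsOpen V → Convex ℝ V → LipschitzOnWith C F V) ∧
      ∀ i, ∀ V ⊆ Ω, IsOpen V → Convex ℝ V → LipschitzOnWith C (G i) V := by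
  have : IsFiniteMeasure (volume.restrict Ω) := ⟨by simpa using hb.measure_lt_top⟩
  choose g hfg hg using hf.2
  choose g' hgg' hg' using fun i => (hg i).2
  obtain ⟨M₁, hM₁⟩ := exists_ae_bound_of_memLp_top fun i => (hg i).1
  obtain ⟨M₂, hM₂⟩ := exists_ae_bound_of_memLp_top (α := Fin d × Fin d)
    (g := fun p => g' p.1 p.2) fun p => (hg' p.1 p.2 : MemLp _ _ _)
  obtain ⟨F, hF, hFl⟩ := exists_lipschitz_representative hΩ (hf.1.integrable le_top) hfg hM₁
  choose G hG hGl using fun i => exists_lipschitz_representative hΩ ((hg i).1.integrable le_top)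
    (hgg' i) fun j => hM₂ (i, j)
  refine ⟨max (d * M₁) (d * M₂), F, G, hF, fun i => (hfg i).congr hF.symm (hG i).symm,
    fun V hV hVo hVc => (hFl V hV hVo hVc).weaken (le_max_left _ _),
    fun i V hV hVo hVc => (hGl i V hV hVo hVc).weaken (le_max_right _ _)⟩

/-- `H^{2,∞}` functions are approximated in `H¹(Ω)` by continuous piecewise affine functions on
shape regular triangulations, as the mesh size tends to zero. -/
theorem exists_feSpace_norm_sub_lt (hΩ : IsOpen Ω) (hint : interior (closure Ω) = Ω) {k : ℕ}
    (hk : 1 ≤ k) {ι : Type*} {𝒯 : ι → Triangulation Ω} (h𝒯 : ShapeRegular 𝒯)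
    (hb : Bornology.IsBounded Ω) (hf : MemSobolevInf Ω 2 f) {u : H1 Ω}
    (hu : val u =ᵐ[volume.restrict Ω] f) {ε : ℝ} (hε : 0 < ε) :
    ∃ h₀ : ℝ, 0 < h₀ ∧ ∀ n, (𝒯 n).meshSize < h₀ → ∃ μ ∈ feSpace k (𝒯 n), ‖u - μ‖ < ε := by
  obtain ⟨σ₀, hσ₀⟩ := h𝒯
  obtain ⟨C, F, G, hFf, hFG, hFl, hGl⟩ := hf.exists_representatives hΩ hb
  set σ := max σ₀ 0 with hσdef
  have hσ0 : 0 ≤ σ := le_max_right _ _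
  have : IsFiniteMeasure (volume.restrict Ω) := ⟨by simpa using hb.measure_lt_top⟩
  have hFc : ContinuousOn F Ω := continuousOn_of_lipschitzOnWith_convex hΩ hFl
  have hFi : IntegrableOn F Ω := (hf.1.integrable le_top).congr hFf.symm
  have huF : val u =ᵐ[volume.restrict Ω] F := hu.trans hFf.symm
  have huG : ∀ i, weakGrad u i =ᵐ[volume.restrict Ω] G i := fun i =>
    ((H1.hasWeakPartial u i).congr huF (Filter.EventuallyEq.refl _ _)).ae_unique hΩ (hFG i)
  -- The gradient constant plus the value constant; the quadratic value error is bounded linearly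
  -- because the mesh size is below `1`.
  set κ : ℝ := C + 2 * (d * C * σ) + 2 * (d * C) with hκ
  have hκ0 : 0 ≤ κ := by positivity
  set m : ℝ := (volume.restrict Ω).real Set.univ ^ (2 : ℝ≥0∞).toReal⁻¹ with hm
  have hm0 : 0 ≤ m := by positivity
  set Λ : ℝ := (d + 1) * (m * κ) + 1 with hΛ
  have hΛ0 : 0 < Λ := by positivity
  refine ⟨min 1 (ε / Λ), by positivity, fun n hn => ?_⟩
  have hcell : ∀ s ∈ (𝒯 n).cellVerts, ∃ (E : Pt d → ℝ) (A : Fin d → ℝ) (b : ℝ), Continuous E ∧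
      (∀ x ∈ Ω, x ∈ convexHull ℝ (s : Set (Pt d)) → E x = F x) ∧
      (∀ p ∈ s, affineFun A b p = E p) ∧ ∀ y ∈ interior (convexHull ℝ (s : Set (Pt d))),
        |F y - affineFun A b y| ≤ κ * (𝒯 n).meshSize ∧
          ∀ i, |G i y - A i| ≤ κ * (𝒯 n).meshSize := by
    intro s hs
    have hTmem := Triangulation.convexHull_mem_cells hs
    obtain ⟨x₀, r, hr, hball, hdiam⟩ := hσ₀ n _ hTmem
    set T : Set (Pt d) := convexHull ℝ (s : Set (Pt d)) with hT
    have hTc : Convex ℝ T := convex_convexHull ℝ _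
    have hUΩ : interior T ⊆ Ω := Triangulation.interior_convexHull_subset hint hs.1
    have hx₀ : x₀ ∈ interior T := mem_interior.2 ⟨Metric.ball x₀ r,
      Metric.ball_subset_closedBall.trans hball, Metric.isOpen_ball, Metric.mem_ball_self hr⟩
    -- Vertices may lie on the boundary of `Ω`, so nodal values come from an extension of `F`
    -- private to this cell.
    obtain ⟨E, hEl, hEF⟩ := (hFl _ hUΩ isOpen_interior hTc.interior).extend_real
    obtain ⟨A, b, hA⟩ := exists_affineFun_interpolating ((𝒯 n).complex.indep hs.1) hs.2 E
    refine ⟨E, A, b, hEl.continuous, fun x hx hxT => ?_, hA, fun y hy => ?_⟩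
    · have hxcl : x ∈ closure (interior T) := by
        rw [hTc.closure_interior_eq_closure_of_nonempty_interior ⟨x₀, hx₀⟩]
        exact subset_closure hxT
      have := mem_closure_iff_nhdsWithin_neBot.1 hxcl
      refine tendsto_nhds_unique (f := E) (l := nhdsWithin x (interior T))
        ((hEl.continuous.tendsto x).mono_left nhdsWithin_le_nhds)
        (((hFc.continuousAt (hΩ.mem_nhds hx)).tendsto.mono_left nhdsWithin_le_nhds).congr' ?_)
      filter_upwards [self_mem_nhdsWithin] with z hz using hEF hz
    · have hσr : Metric.diam T ≤ σ * r :=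
        hdiam.trans (mul_le_mul_of_nonneg_right (le_max_left _ _) hr.le)
      have key := interpolation_error_le hT hr hball hσr (hFc.mono hUΩ) (hFi.mono_set hUΩ)
        (fun i => (hFG i).mono hΩ hUΩ) (fun i => hGl i _ hUΩ isOpen_interior hTc.interior)
        hEl.continuous hEF hA hy
      have hd : Metric.diam T ≤ (𝒯 n).meshSize := Triangulation.diam_le_meshSize hTmem
      have hd0 : 0 ≤ Metric.diam T := Metric.diam_nonneg
      have hd1 : Metric.diam T ≤ 1 := hd.trans (hn.le.trans (min_le_left _ _))
      have hκd : κ * Metric.diam T ≤ κ * (𝒯 n).meshSize := mul_le_mul_of_nonneg_left hd hκ0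
      constructor
      · refine (key.1.trans ?_).trans hκd
        have h1 : d * C * Metric.diam T * Metric.diam T ≤ d * C * Metric.diam T :=
          mul_le_of_le_one_right (by positivity) hd1
        have h2 : 0 ≤ (C + 2 * (d * C * σ)) * Metric.diam T := by positivity
        rw [hκ]
        linarith
      · intro i
        refine ((key.2 i).trans ?_).trans hκd
        have h2 : 0 ≤ 2 * (d * C) * Metric.diam T := by positivity
        rw [hκ]
        linarith
  choose! E A b hE hEF hA herr using hcell
  obtain ⟨μ, hμ, hμv⟩ := Triangulation.exists_mem_feSpace_of_compatible (𝒯 := 𝒯 n) hΩ hk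
    (A := A) (b := b) fun s hs s' hs' x hx hxs hxs' =>
      Triangulation.affineFun_eq_of_interpolating hΩ hint hs hs' (hE s hs) (hE s' hs') (hEF s hs)
        (hEF s' hs') (hA s hs) (hA s' hs') hx hxs hxs'
  refine ⟨μ, hμ, ?_⟩
  have hmesh := (𝒯 n).meshSize_nonneg
  have hval : ‖val (u - μ)‖ ≤ m * (κ * (𝒯 n).meshSize) := by
    refine Lp.norm_le_of_ae_bound (by positivity) ?_
    rw [val_sub]
    filter_upwards [Lp.coeFn_sub (val u) (val μ), huF, hμv,
      Triangulation.ae_exists_mem_interior (𝒯 := 𝒯 n) hΩ] with x h1 h2 h3 h4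
    obtain ⟨s, hs, hxs⟩ := h4
    rw [h1, Pi.sub_apply, h2, (h3 s hs hxs).1]
    exact (herr s hs x hxs).1
  have hgrad : ∀ i, ‖weakGrad (u - μ) i‖ ≤ m * (κ * (𝒯 n).meshSize) := by
    intro i
    refine Lp.norm_le_of_ae_bound (by positivity) ?_
    rw [weakGrad_sub]
    filter_upwards [Lp.coeFn_sub (weakGrad u i) (weakGrad μ i), huG i, hμv,
      Triangulation.ae_exists_mem_interior (𝒯 := 𝒯 n) hΩ] with x h1 h2 h3 h4
    obtain ⟨s, hs, hxs⟩ := h4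
    rw [h1, Pi.sub_apply, h2, (h3 s hs hxs).2 i]
    exact (herr s hs x hxs).2 i
  calc ‖u - μ‖ ≤ ‖val (u - μ)‖ + ∑ i, ‖weakGrad (u - μ) i‖ := H1.norm_le _
    _ ≤ m * (κ * (𝒯 n).meshSize) + ∑ _i : Fin d, m * (κ * (𝒯 n).meshSize) :=
      add_le_add hval (Finset.sum_le_sum fun i _ => hgrad i)
    _ = (d + 1) * (m * κ) * (𝒯 n).meshSize := by
      rw [Finset.sum_const, Finset.card_univ, Fintype.card_fin, nsmul_eq_mul]
      ring
    _ ≤ Λ * (𝒯 n).meshSize := mul_le_mul_of_nonneg_right (by linarith) hmesh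
    _ < ε := by
      have := hn.trans_le (min_le_right _ _)
      rw [lt_div_iff₀ hΛ0] at this
      linarith

/-! ### Orthogonality to approximating families -/

/-- A finite-dimensional space whose elements are approximated by a family of sets contains no
nonzero vector orthogonal to a member of the family with small parameter. -/
theorem exists_forall_orthogonal_eq_zero {X ι : Type*} [NormedAddCommGroup X]
    [InnerProductSpace ℝ X] (W : Submodule ℝ X) [FiniteDimensional ℝ W] {V : ι → Set X}
    {h : ι → ℝ} (happ : ∀ w ∈ W, ∀ ε : ℝ, 0 < ε → ∃ h₀ : ℝ, 0 < h₀ ∧ ∀ n, h n < h₀ →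
      ∃ μ ∈ V n, ‖w - μ‖ < ε) :
    ∃ h₀ : ℝ, 0 < h₀ ∧ ∀ n, h n < h₀ → ∀ w ∈ W, (∀ μ ∈ V n, inner ℝ μ w = 0) → w = 0 := by
  choose! H hH0 hH using fun (w : W) => happ w w.2 (1 / 2) (by norm_num)
  -- A finite `1/2`-net of the unit sphere: the smallest of its thresholds serves all of `W`.
  obtain ⟨t, -, ht⟩ := (isCompact_sphere (0 : W) 1).elim_nhds_subcover
    (fun w => Metric.ball w (1 / 2)) fun w _ => Metric.ball_mem_nhds w (by norm_num)
  obtain ⟨h₀, hh₀, hle⟩ : ∃ h₀ : ℝ, 0 < h₀ ∧ ∀ w ∈ t, h₀ ≤ H w := by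
    rcases t.eq_empty_or_nonempty with rfl | hne
    · exact ⟨1, one_pos, by simp⟩
    · obtain ⟨w, hw, hmin⟩ := t.exists_min_image H hne
      exact ⟨H w, hH0 w, hmin⟩
  refine ⟨h₀, hh₀, fun n hn w hw horth => ?_⟩
  by_contra hw0
  have hnw : ‖w‖ ≠ 0 := norm_ne_zero_iff.2 hw0
  set v : W := ‖w‖⁻¹ • ⟨w, hw⟩ with hv
  have hvn : ‖v‖ = 1 := by
    rw [hv, norm_smul, norm_inv, norm_norm]
    exact inv_mul_cancel₀ hnw
  obtain ⟨y, hy, hvy⟩ := Set.mem_iUnion₂.1 (ht (mem_sphere_zero_iff_norm.2 hvn))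
  obtain ⟨μ, hμ, hyμ⟩ := hH y n (hn.trans_le (hle y hy))
  have h1 : inner ℝ μ (v : X) = 0 := by
    simp [hv, inner_smul_right, horth μ hμ]
  have h2 : ‖(v : X) - μ‖ < 1 := by
    have h3 : ‖(v : X) - y‖ < 1 / 2 := by
      rw [Metric.mem_ball, dist_eq_norm] at hvy
      exact hvy
    calc ‖(v : X) - μ‖ = ‖((v : X) - y) + (y - μ)‖ := by rw [sub_add_sub_cancel]
      _ ≤ ‖(v : X) - y‖ + ‖(y : X) - μ‖ := norm_add_le _ _
      _ < 1 := by linarith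
  have hvX : ‖(v : X)‖ = 1 := hvn
  -- Orthogonality gives `1 = ⟪v - μ, v⟫ ≤ ‖v - μ‖ < 1`.
  have h4 : inner ℝ ((v : X) - μ) (v : X) = 1 := by
    rw [inner_sub_left, h1, real_inner_self_eq_norm_sq, hvX]
    norm_num
  have h5 := real_inner_le_norm ((v : X) - μ) (v : X)
  rw [h4, hvX, mul_one] at h5
  linarith

/-! ### Elementary bounds for the angle distance -/

theorem angleDist_le_one {X : Type*} [SeminormedAddCommGroup X] {A B : Set X} (h0 : 0 ∈ B) :
    angleDist A B ≤ 1 := by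
  refine Real.iSup_le (fun w => ?_) zero_le_one
  refine (ciInf_le ⟨0, ?_⟩ (⟨0, h0⟩ : B)).trans ?_
  · rintro _ ⟨v, rfl⟩
    exact norm_nonneg _
  · simp [w.2.2]

theorem angleDist_self {X : Type*} [SeminormedAddCommGroup X] (A : Set X) :
    angleDist A A ≤ 0 := by
  refine Real.iSup_le (fun w => ?_) le_rfl
  refine (ciInf_le ⟨0, ?_⟩ (⟨w, w.2.1⟩ : A)).trans (by simp)
  rintro _ ⟨v, rfl⟩
  exact norm_nonneg _

end StrainEnergy

end

noncomputable section

namespace StrainEnergy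

variable {d : ℕ} {Ω : Set (Pt d)} {f : Pt d → ℝ}

/-! ### The products of affine fields with the director field -/

theorem MemSobolevInf.zero (hΩ : IsOpen Ω) : ∀ m : ℕ, MemSobolevInf Ω m fun _ => 0
  | 0 => MemLp.zero'
  | m + 1 => ⟨MemLp.zero', fun i => ⟨fun _ => 0, by
      simpa using HasWeakPartial.of_smooth (a := fun _ => (0 : ℝ)) contDiff_const hΩ i,
      MemSobolevInf.zero hΩ m⟩⟩

theorem MemSobolevInf.finsetSum (hΩ : IsOpen Ω) {m : ℕ} {α : Type*} (t : Finset α)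
    {f : α → Pt d → ℝ} (hf : ∀ a ∈ t, MemSobolevInf Ω m (f a)) :
    MemSobolevInf Ω m fun x => ∑ a ∈ t, f a x := by
  classical
  induction t using Finset.induction_on with
  | empty => simpa using MemSobolevInf.zero hΩ m
  | insert a t ha ih =>
    simp only [Finset.sum_insert ha]
    exact (hf a (Finset.mem_insert_self a t)).add hΩ
      (ih fun b hb => hf b (Finset.mem_insert_of_mem hb))

theorem MemSobolevInf.exists_H1 (hb : Bornology.IsBounded Ω) {m : ℕ}
    (hf : MemSobolevInf Ω (m + 1) f) : ∃ u : H1 Ω, val u =ᵐ[volume.restrict Ω] f := by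
  have : IsFiniteMeasure (volume.restrict Ω) := ⟨by simpa using hb.measure_lt_top⟩
  choose g hfg hg using hf.2
  obtain ⟨u, hu, -⟩ := H1.exists_of_memLp (hf.1.mono_exponent le_top)
    (fun i => (hg i).memLp.mono_exponent le_top) hfg
  exact ⟨u, hu⟩

/-- The product `v · ẑ` of the affine vector field `v x = b + A x` with `ẑ`. -/
def affineDot (z : Pt d → Pt d) (P : (Fin d → Fin d → ℝ) × (Fin d → ℝ)) (x : Pt d) : ℝ :=
  ∑ i, affineFun (P.1 i) (P.2 i) x * z x i

theorem memSobolevInf_affineDot (hΩ : IsOpen Ω) (hb : Bornology.IsBounded Ω) {m : ℕ}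
    {z : Pt d → Pt d} (hz : ∀ i, MemSobolevInf Ω m fun x => z x i)
    (P : (Fin d → Fin d → ℝ) × (Fin d → ℝ)) : MemSobolevInf Ω m (affineDot z P) :=
  MemSobolevInf.finsetSum hΩ _ fun i _ => (hz i).smooth_mul hΩ hb (contDiff_affineFun _ _)

theorem affineDot_add (z : Pt d → Pt d) (P Q : (Fin d → Fin d → ℝ) × (Fin d → ℝ)) (x : Pt d) :
    affineDot z (P + Q) x = affineDot z P x + affineDot z Q x := by
  simp only [affineDot, affineFun, ← Finset.sum_add_distrib, Prod.fst_add, Prod.snd_add,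
    Pi.add_apply, add_mul]
  refine Finset.sum_congr rfl fun i _ => ?_
  rw [Finset.sum_add_distrib]
  ring

theorem affineDot_smul (z : Pt d → Pt d) (c : ℝ) (P : (Fin d → Fin d → ℝ) × (Fin d → ℝ))
    (x : Pt d) : affineDot z (c • P) x = c * affineDot z P x := by
  simp only [affineDot, affineFun, Finset.mul_sum, Prod.smul_fst, Prod.smul_snd, Pi.smul_apply,
    smul_eq_mul, mul_assoc]
  refine Finset.sum_congr rfl fun i _ => ?_
  rw [← Finset.mul_sum]
  ring

/-- The products of affine fields with a Sobolev field form a finite-dimensional space of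
`H^{m,∞}` functions. -/
theorem exists_submodule_affineDot (hΩ : IsOpen Ω) (hb : Bornology.IsBounded Ω) {m : ℕ}
    {z : Pt d → Pt d} (hz : ∀ i, MemSobolevInf Ω (m + 1) fun x => z x i) :
    ∃ W : Submodule ℝ (H1 Ω), FiniteDimensional ℝ W ∧
      (∀ w ∈ W, ∃ f, MemSobolevInf Ω (m + 1) f ∧ val w =ᵐ[volume.restrict Ω] f) ∧
      ∀ P, ofFun Ω (affineDot z P) ∈ W := by
  have hval : ∀ P, val (ofFun Ω (affineDot z P)) =ᵐ[volume.restrict Ω] affineDot z P := fun P => by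
    obtain ⟨u, hu⟩ := (memSobolevInf_affineDot hΩ hb hz P).exists_H1 hb
    rwa [ofFun_eq hΩ hu]
  let Φ : (Fin d → Fin d → ℝ) × (Fin d → ℝ) →ₗ[ℝ] H1 Ω :=
    -- `ofFun` is not additive in general, because of its default value `0`; here every product does
    -- belong to `H¹(Ω)`.
    { toFun := fun P => ofFun Ω (affineDot z P)
      map_add' := fun P Q => ofFun_eq hΩ (by
        rw [val_add]
        filter_upwards [Lp.coeFn_add (val (ofFun Ω (affineDot z P)))
          (val (ofFun Ω (affineDot z Q))), hval P, hval Q] with x h1 h2 h3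
        rw [h1, Pi.add_apply, h2, h3, affineDot_add])
      map_smul' := fun c P => ofFun_eq hΩ (by
        rw [val_smul]
        filter_upwards [Lp.coeFn_smul c (val (ofFun Ω (affineDot z P))), hval P] with x h1 h2
        rw [RingHom.id_apply, h1, Pi.smul_apply, h2, affineDot_smul, smul_eq_mul]) }
  refine ⟨LinearMap.range Φ, inferInstance, ?_, fun P => ⟨P, rfl⟩⟩
  rintro _ ⟨P, rfl⟩
  exact ⟨_, memSobolevInf_affineDot hΩ hb hz P, hval P⟩

theorem dotField_eq_ofFun_affineDot (hΩ : IsOpen Ω) (hc : IsPreconnected Ω)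
    (hb : Bornology.IsBounded Ω) {m : ℕ} {z : Pt d → Pt d}
    (hz : ∀ i, MemSobolevInf Ω (m + 1) fun x => z x i) {v : H1Vec Ω} (hv : v ∈ rigidMotions Ω) :
    ∃ P, dotField z v = ofFun Ω (affineDot z P) := by
  choose A b hA using exists_affine_of_mem_rigidMotions hΩ hc hb hv
  refine ⟨(A, b), ?_⟩
  obtain ⟨u, hu⟩ := (memSobolevInf_affineDot hΩ hb hz (A, b)).exists_H1 hb
  rw [ofFun_eq hΩ hu]
  refine ofFun_eq hΩ (hu.trans ?_)
  filter_upwards [ae_all_iff.2 hA] with x hx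
  simp only [affineDot, hx]

/-- Rigid motions are affine, so one polynomial of degree at most one serves every cell. This yields
the inclusion of the exact kernel in the discrete one. -/
theorem mem_feSpaceVec_of_mem_rigidMotions (hΩ : IsOpen Ω) (hc : IsPreconnected Ω) {k : ℕ}
    (hk : 1 ≤ k) (𝒯 : Triangulation Ω) {v : H1Vec Ω} (hv : v ∈ rigidMotions Ω) :
    v ∈ feSpaceVec k 𝒯 := by
  intro i
  obtain ⟨A, b, hA⟩ := exists_affine_of_mem_rigidMotions hΩ hc 𝒯.isBounded hv i
  obtain ⟨p, hp, hpe⟩ := exists_mvPolynomial_eq_affineFun hk A b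
  exact ⟨affineFun A b, hA, (contDiff_affineFun A b).continuous.continuousOn,
    fun T _ => ⟨p, hp, fun x _ => hpe x⟩⟩

theorem zero_mem_kernelSpace (hΩ : IsOpen Ω) (z : Pt d → Pt d) : 0 ∈ kernelSpace Ω z := by
  have hLp : ((0 : L2 Ω) : Pt d → ℝ) =ᵐ[volume.restrict Ω] 0 := Lp.coeFn_zero _ _ _
  have hdot : dotField z (0 : H1Vec Ω) = 0 := by
    refine ofFun_eq hΩ ?_
    filter_upwards [hLp] with x hx
    have h1 : val (0 : H1 Ω) x = 0 := hx
    simp [h1]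
  refine ⟨fun μ => by rw [bForm, hdot, inner_zero_right], ?_⟩
  have hs : ∀ i j, strain (0 : H1Vec Ω) i j = 0 := fun i j => add_zero (0 : L2 Ω)
  change aForm 0 0 = 0
  refine integral_eq_zero_of_ae ?_
  filter_upwards [hLp] with x hx
  simp only [hs, hx]
  simp

end StrainEnergy

end

/-! ### Equality of the kernels on fine meshes and the distance estimate -/

theorem lemma5p2 {d : ℕ} (hd : d = 2 ∨ d = 3) {Ω : Set (StrainEnergy.Pt d)}
    (hΩ : StrainEnergy.IsPolygonalDomain Ω) {k : ℕ} (hk : 1 ≤ k)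
    (z : StrainEnergy.Pt d → StrainEnergy.Pt d)
    (hz : ∀ i, StrainEnergy.MemSobolevInf Ω (k + 1) fun x => z x i)
    (hz_unit : ∀ᵐ x ∂volume.restrict Ω, ‖z x‖ = 1)
    {ι : Type*} (𝒯 : ι → StrainEnergy.Triangulation Ω) (h𝒯 : StrainEnergy.ShapeRegular 𝒯) :
    (∃ c : ℝ, ∀ i, StrainEnergy.angleDist (StrainEnergy.discreteKernel k (𝒯 i) z)
        (StrainEnergy.kernelSpace Ω z) ≤ c * (𝒯 i).meshSize ^ k) ∧
      ∃ h₀ : ℝ, 0 < h₀ ∧ ∀ i, (𝒯 i).meshSize < h₀ →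
        StrainEnergy.kernelSpace Ω z = StrainEnergy.discreteKernel k (𝒯 i) z := by
  open StrainEnergy in
  have hc := hΩ.isConnected.isPreconnected
  have hequal : ∃ h₀ : ℝ, 0 < h₀ ∧ ∀ i, (𝒯 i).meshSize < h₀ →
      kernelSpace Ω z = discreteKernel k (𝒯 i) z := by
    -- A member of the family is used to see that `Ω` is bounded.
    rcases isEmpty_or_nonempty ι with hι | ⟨⟨i₀⟩⟩
    · exact ⟨1, one_pos, fun i => isEmptyElim i⟩
    have hb := (𝒯 i₀).isBounded
    obtain ⟨W, hWfd, hWf, hWm⟩ := exists_submodule_affineDot hΩ.isOpen hb hz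
    obtain ⟨h₀, hh₀, horth⟩ := exists_forall_orthogonal_eq_zero W
      (V := fun i => feSpace k (𝒯 i)) (h := fun i => (𝒯 i).meshSize) fun w hw ε hε => by
        obtain ⟨f, hf, hwf⟩ := hWf w hw
        exact exists_feSpace_norm_sub_lt hΩ.isOpen hΩ.interior_closure hk h𝒯 hb
          (hf.of_le (by omega)) hwf hε
    refine ⟨h₀, hh₀, fun i hi => Set.Subset.antisymm ?_ ?_⟩
    · rintro v ⟨hvb, hvK⟩
      exact ⟨⟨mem_feSpaceVec_of_mem_rigidMotions hΩ.isOpen hc hk _ hvK, fun μ _ => hvb μ⟩, hvK⟩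
    · rintro v ⟨⟨-, hvb⟩, hvK⟩
      obtain ⟨P, hP⟩ := dotField_eq_ofFun_affineDot hΩ.isOpen hc hb hz hvK
      have h0 : dotField z v = 0 := horth i hi _ (hP ▸ hWm P) hvb
      exact ⟨fun μ => by rw [bForm, h0, inner_zero_right], hvK⟩
  refine ⟨?_, hequal⟩
  obtain ⟨h₀, hh₀, heq⟩ := hequal
  -- With this constant the right-hand side is `(h / h₀)^k`, at least `1` exactly where the kernels
  -- might differ.
  refine ⟨(h₀ ^ k)⁻¹, fun i => ?_⟩
  have hmesh := (𝒯 i).meshSize_nonneg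
  rcases lt_or_ge (𝒯 i).meshSize h₀ with hlt | hge
  · rw [heq i hlt]
    exact (angleDist_self _).trans (by positivity)
  · refine (angleDist_le_one (zero_mem_kernelSpace hΩ.isOpen z)).trans ?_
    rw [inv_mul_eq_div, one_le_div (by positivity)]
    exact pow_le_pow_left₀ hh₀.le hge k
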